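/- **Setting.** An *origami* is a compact connected surface $X$ with a ramified covering $\rho:X\to\mathbb{T}^2=\mathbb{R}^2/\mathbb{Z}^2$ unramified outside $0$; it carries the pulled-back translation structure. The group $SL(2,\mathbb{Z})$ acts by $A\cdot(X,\rho)=(X,A\circ\rho)$. Its conical singularities are the ramification points of $\rho$, and $\mathrm{hol}(X)\subset\mathbb{C}$ is the set of periods of its saddle connections. The orbit B7 is the set of primitive origamis (those with $\langle\mathrm{hol}(X)\rangle=\mathbb{Z}^2$) with $7$ squares in the stratum $\mathcal{H}(2)$ which have exactly three integer Weierstrass points, that is, three fixed points of the hyperelliptic involution lying over $0\in\mathbb{T}^2$. The multiplicity of a saddle connection is the degree of its projection to $\mathbb{T}^2$ onto the closed geodesic that is its image, and $m(Y)=m(\infty;Y)$ is the minimal multiplicity of a horizontal saddle connection of the origami $Y$. For a translation surface $S$ of area one let $$L(S)=\limsup_{v\in\mathrm{hol}(S),\ |\mathrm{Im}\,v|\to\infty}\frac{1}{|\mathrm{Re}\,v|\cdot|\mathrm{Im}\,v|}\in[0,\infty],$$ and for an origami $X$ and $\alpha\in\mathbb{R}$ let $L(X,\alpha)=L(r_{\arctan\alpha}\cdot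 X)$, where $X$ is rescaled to area one and $r_\theta=\begin{pmatrix}\cos\theta&-\sin\theta\\ \sin\theta&\cos\theta\end{pmatrix}$. Let $T=\begin{pmatrix}1&1\\0&1\end{pmatrix}$, $R=\begin{pmatrix}0&-1\\1&0\end{pmatrix}$ and, for positive integers $a_1,\dots,a_n$, $$g(a_1,\dots,a_n)=(T^{(-1)^{n-1}a_n}R)\cdots(T^{-a_2}R)(T^{a_1}R).$$ Write an irrational number as $\alpha=a_0+[a_1,a_2,\dots]$ with $a_0=\lfloor\alpha\rfloor$, where $[a_1,a_2,\dots]=\cfrac{1}{a_1+\cfrac{1}{a_2+\cdots}}$, and for $n\ge1$, $1\le i\le a_n$ put $$D(n,i,\alpha)=\begin{cases}[a_n,\dots,a_1]+a_{n+1}+[a_{n+2},a_{n+3},\dots]&\text{if }i=a_n,\\ [i,a_{n-1},\dots,a_1]+[a_n-i,a_{n+1},a_{n+2},\dots]&\text{if }1\le i<a_n.\end{cases}$$ **Statement.** Let $X$ be any origami in the orbit B7. Then $m(A\cdot X)\in\{1,2\}$ for every $A\in SL(2,\mathbb{Z})$, and for every irrational number $\alpha=a_0+[a_1,a_2,\dots]$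 we have, in $[0,\infty]$, $$L(X,\alpha)=7\cdot\limsup_{n\to\infty}\ \max_{1\le i\le a_n}\ \frac{D(n,i,\alpha)}{m^2\big(R\cdot g(a_1,\dots,a_{n-1},i)\cdot T^{-a_0}\cdot X\big)}.$$ In particular, for $0<\alpha<1$ we have $a_0=0$ and the factor $T^{-a_0}$ is absent. -/

import Mathlib

open Filter Topology

universe u

/-- The standard torus `ℝ² / ℤ²`. -/
abbrev Torus : Type := UnitAddCircle × UnitAddCircle

namespace Torus

/-- The universal covering `ℂ = ℝ² → ℝ² / ℤ²`. -/
noncomputable def mk (z : ℂ) : Torus := ((z.re : UnitAddCircle), (z.im : UnitAddCircle))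

/-- The automorphism of the torus induced by an element of `SL(2, ℤ)`. -/
def sl (A : Matrix.SpecialLinearGroup (Fin 2) ℤ) (p : Torus) : Torus :=
  (A 0 0 • p.1 + A 0 1 • p.2, A 1 0 • p.1 + A 1 1 • p.2)

/-- The linear action of `SL(2, ℤ)` on `ℂ = ℝ²`. -/
noncomputable def slPlane (A : Matrix.SpecialLinearGroup (Fin 2) ℤ) (z : ℂ) : ℂ :=
  ⟨A 0 0 * z.re + A 0 1 * z.im, A 1 0 * z.re + A 1 1 * z.im⟩

theorem continuous_sl (A : Matrix.SpecialLinearGroup (Fin 2) ℤ) : Continuous (sl A) := by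
  unfold sl
  fun_prop

theorem sl_mul (A B : Matrix.SpecialLinearGroup (Fin 2) ℤ) (p : Torus) :
    sl (A * B) p = sl A (sl B p) := by
  ext <;> simp only [sl, Matrix.SpecialLinearGroup.coe_mul, Matrix.mul_apply, Fin.sum_univ_two,
    add_smul, smul_add, mul_smul] <;> abel

theorem sl_one (p : Torus) : sl 1 p = p := by
  ext <;> simp [sl]

theorem sl_add (A : Matrix.SpecialLinearGroup (Fin 2) ℤ) (p q : Torus) :
    sl A (p + q) = sl A p + sl A q := by
  ext <;> simp only [sl, Prod.fst_add, Prod.snd_add, smul_add] <;> abel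

theorem sl_zero (A : Matrix.SpecialLinearGroup (Fin 2) ℤ) : sl A 0 = 0 := by
  ext <;> simp [sl]

theorem sl_mk (A : Matrix.SpecialLinearGroup (Fin 2) ℤ) (z : ℂ) :
    sl A (mk z) = mk (slPlane A z) := by
  ext <;> simp [sl, mk, slPlane]

theorem slPlane_mul (A B : Matrix.SpecialLinearGroup (Fin 2) ℤ) (z : ℂ) :
    slPlane (A * B) z = slPlane A (slPlane B z) := by
  apply Complex.ext <;>
    simp only [slPlane, Matrix.SpecialLinearGroup.coe_mul, Matrix.mul_apply, Fin.sum_univ_two] <;>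
    push_cast <;> ring

theorem slPlane_one (z : ℂ) : slPlane 1 z = z := by
  apply Complex.ext <;> simp [slPlane]

/-- The automorphism `sl A` as a homeomorphism. -/
def slHomeo (A : Matrix.SpecialLinearGroup (Fin 2) ℤ) : Torus ≃ₜ Torus where
  toFun := sl A
  invFun := sl A⁻¹
  left_inv p := by rw [← sl_mul, inv_mul_cancel, sl_one]
  right_inv p := by rw [← sl_mul, mul_inv_cancel, sl_one]
  continuous_toFun := continuous_sl A
  continuous_invFun := continuous_sl A⁻¹

/-- The linear map `slPlane A` as a real-linear equivalence. -/
noncomputable def slPlaneEquiv (A : Matrix.SpecialLinearGroup (Fin 2) ℤ) : ℂ ≃L[ℝ] ℂ :=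
  LinearEquiv.toContinuousLinearEquiv
    { toFun := slPlane A
      invFun := slPlane A⁻¹
      left_inv := fun z => by rw [← slPlane_mul, inv_mul_cancel, slPlane_one]
      right_inv := fun z => by rw [← slPlane_mul, mul_inv_cancel, slPlane_one]
      map_add' := fun z w => by
        apply Complex.ext <;> simp [slPlane] <;> ring
      map_smul' := fun r z => by
        apply Complex.ext <;> simp [slPlane] <;> ring }

theorem slPlaneEquiv_apply (A : Matrix.SpecialLinearGroup (Fin 2) ℤ) (z : ℂ) :
    slPlaneEquiv A z = slPlane A z := rfl

end Torus

/-- `f : S → ℝ²/ℤ²` is, near `x`, the map `z ↦ z ^ k` in suitable coordinates: a chart `φ` of `S`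
centred at `x` and linear coordinates `E` on the plane covering the torus. For a square-tiled
surface with covering map `f` this says that the cone angle at `x` is `2πk`. -/
def HasRamificationIndex {S : Type u} [TopologicalSpace S] (f : S → Torus) (x : S) (k : ℕ) : Prop :=
  ∃ (φ : OpenPartialHomeomorph S ℂ) (E : ℂ ≃L[ℝ] ℂ), x ∈ φ.source ∧ φ x = 0 ∧
    ∀ y ∈ φ.source, f y = f x + Torus.mk (E (φ y ^ k))

/-- An origami (square-tiled surface): a compact connected surface with a ramified covering of the
torus `ℝ²/ℤ²` which is unramified outside `0`. Its translation structure is the pull-back of the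
one of the torus, so that the surface is tiled by copies of the unit square. -/
structure Origami : Type (u + 1) where
  carrier : Type u
  [topologicalSpace : TopologicalSpace carrier]
  [t2Space : T2Space carrier]
  [compactSpace : CompactSpace carrier]
  [connectedSpace : ConnectedSpace carrier]
  proj : carrier → Torus
  continuous_proj : Continuous proj
  isCoveringMapOn : IsCoveringMapOn proj {0}ᶜ
  ramified : ∀ x, proj x = 0 → ∃ k : ℕ, 1 ≤ k ∧ HasRamificationIndex proj x k

namespace Origami

attribute [instance] Origami.topologicalSpace Origami.t2Space Origami.compactSpace
  Origami.connectedSpace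

theorem isCoveringMapOn_sl {S : Type u} [TopologicalSpace S] {f : S → Torus}
    (hf : IsCoveringMapOn f {0}ᶜ) (A : Matrix.SpecialLinearGroup (Fin 2) ℤ) :
    IsCoveringMapOn (fun x => Torus.sl A (f x)) {0}ᶜ := by
  intro x hx
  let e := Torus.slHomeo A
  have hx' : e.symm x ∈ ({0}ᶜ : Set Torus) := by
    intro h0
    apply hx
    have h1 : e (e.symm x) = e 0 := congrArg _ h0
    rw [Homeomorph.apply_symm_apply] at h1
    exact h1.trans (Torus.sl_zero A)
  obtain ⟨hI, U, hxU, hU, hfU, H, hH⟩ := hf _ hx'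
  have key : IsEvenlyCovered (fun y => Torus.sl A (f y)) x (f ⁻¹' {e.symm x}) := by
    have hpre : (fun y => Torus.sl A (f y)) ⁻¹' (e.symm ⁻¹' U) = f ⁻¹' U := by
      ext y
      change e.symm (e (f y)) ∈ U ↔ f y ∈ U
      rw [Homeomorph.symm_apply_apply]
    refine ⟨hI, e.symm ⁻¹' U, hxU, hU.preimage e.symm.continuous, hpre ▸ hfU, ?_⟩
    have hUe : ∀ p : Torus, p ∈ U ↔ e p ∈ e.symm ⁻¹' U := fun p => by
      simp
    refine ⟨((Homeomorph.setCongr hpre).trans H).trans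
      ((e.subtype hUe).prodCongr (Homeomorph.refl _)), ?_⟩
    intro y
    exact congrArg e (hH (Homeomorph.setCongr hpre y))
  exact key.to_isEvenlyCovered_preimage

theorem hasRamificationIndex_sl {S : Type u} [TopologicalSpace S] {f : S → Torus} {x : S} {k : ℕ}
    (h : HasRamificationIndex f x k) (A : Matrix.SpecialLinearGroup (Fin 2) ℤ) :
    HasRamificationIndex (fun y => Torus.sl A (f y)) x k := by
  obtain ⟨φ, E, hx, h0, hφ⟩ := h
  refine ⟨φ, E.trans (Torus.slPlaneEquiv A), hx, h0, fun y hy => ?_⟩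
  simp only [hφ y hy, Torus.sl_add, Torus.sl_mk, ContinuousLinearEquiv.trans_apply,
    Torus.slPlaneEquiv_apply]

/-- The action of `SL(2, ℤ)` on origamis: `A • X` is the same surface, and its translation
structure (hence its covering of the torus) is composed with `A`. -/
instance : SMul (Matrix.SpecialLinearGroup (Fin 2) ℤ) Origami.{u} where
  smul A X :=
    { carrier := X.carrier
      proj := fun x => Torus.sl A (X.proj x)
      continuous_proj := (Torus.continuous_sl A).comp X.continuous_proj
      isCoveringMapOn := isCoveringMapOn_sl X.isCoveringMapOn A
      ramified := fun x hx => by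
        have hx0 : X.proj x = 0 := by
          have h1 := congrArg (Torus.sl A⁻¹) hx
          rwa [← Torus.sl_mul, inv_mul_cancel, Torus.sl_one, Torus.sl_zero] at h1
        obtain ⟨k, hk, h⟩ := X.ramified x hx0
        exact ⟨k, hk, hasRamificationIndex_sl h A⟩ }

variable (X : Origami.{u})

/-- The conical singularities: points with cone angle `2πk`, `k ≥ 2`. -/
def IsSingular (x : X.carrier) : Prop :=
  ∃ k : ℕ, 2 ≤ k ∧ HasRamificationIndex X.proj x k

/-- `γ` is a saddle connection with period `v`: a straight segment on the surface (a lift of the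
segment of constant velocity `v` on the torus) which joins two conical singularities and contains
no singularity in its interior. -/
def IsSaddleConnection (γ : C(unitInterval, X.carrier)) (v : ℂ) : Prop :=
  v ≠ 0 ∧ X.IsSingular (γ 0) ∧ X.IsSingular (γ 1) ∧
    (∀ t : unitInterval, 0 < t → t < 1 → ¬ X.IsSingular (γ t)) ∧
    ∀ t : unitInterval, X.proj (γ t) = X.proj (γ 0) + Torus.mk ((t : ℝ) * v)

/-- The set of periods of saddle connections. -/
def hol : Set ℂ := {v | ∃ γ, X.IsSaddleConnection γ v}

/-- The number of unit squares, counted by their centres; it is also the area of the surface. -/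
noncomputable def numSquares : ℕ :=
  Nat.card (X.proj ⁻¹' {Torus.mk (1 / 2 + 1 / 2 * Complex.I)})

/-- The stratum `H(2)`: one conical singularity, of angle `6π`. -/
def InStratumTwo : Prop :=
  ∃ x₀ : X.carrier, HasRamificationIndex X.proj x₀ 3 ∧
    ∀ x, x ≠ x₀ → HasRamificationIndex X.proj x 1

/-- The periods generate `ℤ² = ℤ + ℤ i`. -/
def IsPrimitive : Prop :=
  (AddSubgroup.closure X.hol : Set ℂ) = {v | ∃ p q : ℤ, v = p + q * Complex.I}

/-- An involution with derivative `-1`. On a surface in `H(2)` there is exactly one, namely the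
hyperelliptic involution. -/
def IsHyperellipticInvolution (ι : X.carrier ≃ₜ X.carrier) : Prop :=
  Function.Involutive ι ∧ ∀ x, X.proj (ι x) = -X.proj x

/-- The orbit B7: primitive origamis with `7` squares in `H(2)` with exactly three integer
Weierstrass points (fixed points of the hyperelliptic involution which are vertices of squares). -/
def IsOrbitB7 : Prop :=
  X.numSquares = 7 ∧ X.InStratumTwo ∧ X.IsPrimitive ∧
    ∃ ι, X.IsHyperellipticInvolution ι ∧ {x | ι x = x ∧ X.proj x = 0}.ncard = 3

/-- `k` is the degree of a closed geodesic `t ↦ t v` (`t ∈ [0, 1]`) of the torus onto its image: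
`v` is `k` times a primitive integer vector. -/
def HasDegree (v : ℂ) (k : ℕ) : Prop :=
  0 < k ∧ ∃ p q : ℤ, IsCoprime p q ∧ v = k * (p + q * Complex.I)

/-- The multiplicity `m(p/q; X)`: the minimal degree over the torus among the saddle connections
whose period is parallel to `p + i q`. In particular `m(∞; X) = X.multiplicity 1 0` is the minimal
multiplicity of a horizontal saddle connection. -/
noncomputable def multiplicity (p q : ℤ) : ℕ :=
  sInf {k | ∃ v ∈ X.hol, v.re * q - v.im * p = 0 ∧ HasDegree v k}

/-- `limsup 1 / (|Re v| |Im v|)` over the `v` in a set of periods with `|Im v| → ∞`,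
as an element of `[0, ∞]`. -/
noncomputable def lagrangeOfPeriods (H : Set ℂ) : ENNReal :=
  limsup (fun v : ℂ => (ENNReal.ofReal (|v.re| * |v.im|))⁻¹)
    (comap (fun v : ℂ => |v.im|) atTop ⊓ 𝓟 H)

/-- `L(X, α) = L(r_θ · X)` with `θ = arctan α`, the surface being normalized to area one. -/
noncomputable def lagrange (α : ℝ) : ENNReal :=
  lagrangeOfPeriods
    ((fun v : ℂ => Complex.exp (Real.arctan α * Complex.I) * v / (√(X.numSquares : ℝ) : ℂ)) '' X.hol)

end Origami

namespace CFrac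

/-- The entry `a_n` of `α = a_0 + [a_1, a_2, …]`. -/
noncomputable def entry (α : ℝ) (n : ℕ) : ℤ :=
  ((GenContFract.IntFractPair.stream α n).map GenContFract.IntFractPair.b).getD 0

/-- The tail `[a_{n+1}, a_{n+2}, …]` of `α = a_0 + [a_1, a_2, …]`. -/
noncomputable def tail (α : ℝ) (n : ℕ) : ℝ :=
  ((GenContFract.IntFractPair.stream α n).map GenContFract.IntFractPair.fr).getD 0

/-- The finite continued fraction `[a_n, a_{n-1}, …, a_1]`. -/
noncomputable def reversed (a : ℕ → ℤ) : ℕ → ℝ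
  | 0 => 0
  | n + 1 => 1 / (a (n + 1) + reversed a n)

/-- `D(n, i, α)`, that is `[a_n, …, a_1] + a_{n+1} + [a_{n+2}, …]` if `i = a_n`, and
`[i, a_{n-1}, …, a_1] + [a_n - i, a_{n+1}, …]` otherwise. -/
noncomputable def D (n : ℕ) (i : ℤ) (α : ℝ) : ℝ :=
  if i = entry α n then
    reversed (entry α) n + entry α (n + 1) + tail α (n + 1)
  else
    reversed (Function.update (entry α) n i) n + 1 / (((entry α n - i : ℤ) : ℝ) + tail α n)

/-- `g(a_1, …, a_n) = ⋯ (T^{a_3} R) (T^{-a_2} R) (T^{a_1} R)`, where `R = !![0, -1; 1, 0]`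
is called `ModularGroup.S` in Mathlib. -/
def g (a : ℕ → ℤ) : ℕ → Matrix.SpecialLinearGroup (Fin 2) ℤ
  | 0 => 1
  | n + 1 => ModularGroup.T ^ ((-1) ^ n * a (n + 1)) * ModularGroup.S * g a n

end CFrac

/-! Write a period as v = k(p + qi) with p, q coprime and q > 0, and put W = q|qα − p|. After
rotation by arctan α and normalization of the area, |Re v|·|Im v| equals k²W/7 up to a correction
quadratic in the error k|qα − p| (`rotation_coordinates`). In a fixed direction the best k is the
minimal multiplicity m, so L(X, α) compares with 7/(m²W). For an intermediate convergent, 1/W is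
exactly D (`D_mul_eq_one`), and R·g·T^{-a_0} makes its direction horizontal (`slPlane_S_mul_g`), so
the multiplicity in the formula is that of the direction (`multiplicity_eq_convMult`). Since every
D/m² comes from an actual period, L is at least the right-hand side (`exists_period_of_convMult`).

For the converse, other rational directions must not matter. An approximation with W < 1 and large
denominator is a convergent or an intermediate convergent (`exists_intermediate`), so it suffices
that the limsup of max D/m² is at least 1 (`frequently_one_le`).

This is where the geometry enters, through counting. Three of the seven squares have their lower
left vertex at the singularity. If there were no horizontal period 1 or 2, these three and their
first and second right neighbours would be nine distinct squares; hence m ≤ 2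
(`horizontal_mem_hol`). A similar count shows that among 1, i and 1 + i some direction has m = 1
(`triangle_mem_hol`), and the action of SL(2, ℤ) spreads both facts to all directions. If now D/m² <
1 from some point on, all late convergents have m = 2, the late entries are 2 or 3, and a first
intermediate convergent, the sum of two vectors with m = 2, has m = 1 and D ≥ 2/3 + 2/5 > 1: a
contradiction. -/

namespace Torus

/-! ### Lattice points in the plane covering the torus. -/

theorem continuous_mk : Continuous mk := by
  unfold mk
  exact ((AddCircle.continuous_mk' 1).comp Complex.continuous_re).prodMk
    ((AddCircle.continuous_mk' 1).comp Complex.continuous_im)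

theorem mk_add (z w : ℂ) : mk (z + w) = mk z + mk w := by
  ext <;> simp [mk]

theorem mk_eq_zero_iff {z : ℂ} : mk z = 0 ↔ ∃ p q : ℤ, z = p + q * Complex.I := by
  simp only [mk, Prod.ext_iff, Prod.fst_zero, Prod.snd_zero, AddCircle.coe_eq_zero_iff]
  constructor
  · rintro ⟨⟨p, hp⟩, ⟨q, hq⟩⟩
    refine ⟨p, q, Complex.ext ?_ ?_⟩
    · simpa using hp.symm
    · simpa using hq.symm
  · rintro ⟨p, q, rfl⟩
    exact ⟨⟨p, by simp⟩, ⟨q, by simp⟩⟩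

theorem mk_int (p q : ℤ) : mk (p + q * Complex.I) = 0 := mk_eq_zero_iff.2 ⟨p, q, rfl⟩

theorem mk_ne_zero_of_re {z : ℂ} (h0 : 0 < z.re) (h1 : z.re < 1) : mk z ≠ 0 := by
  rw [Ne, mk_eq_zero_iff]
  rintro ⟨p, q, rfl⟩
  simp only [Complex.add_re, Complex.intCast_re, Complex.mul_re, Complex.intCast_im, Complex.I_re,
    Complex.I_im, mul_zero, zero_mul, sub_zero, add_zero] at h0 h1
  norm_cast at h0 h1
  lia

theorem mk_ne_zero_of_im {z : ℂ} (h0 : 0 < z.im) (h1 : z.im < 1) : mk z ≠ 0 := by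
  rw [Ne, mk_eq_zero_iff]
  rintro ⟨p, q, rfl⟩
  simp only [Complex.add_im, Complex.intCast_im, Complex.mul_im, Complex.intCast_re, Complex.I_re,
    Complex.I_im, mul_zero, mul_one, zero_add, add_zero] at h0 h1
  norm_cast at h0 h1
  lia

theorem eq_zero_of_mk_eq_zero {z : ℂ} (h : mk z = 0) (hz : ‖z‖ < 1) : z = 0 := by
  obtain ⟨p, q, rfl⟩ := mk_eq_zero_iff.1 h
  have h1 := (Complex.abs_re_le_norm _).trans_lt hz
  have h2 := (Complex.abs_im_le_norm _).trans_lt hz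
  simp only [Complex.add_re, Complex.intCast_re, Complex.mul_re, Complex.intCast_im, Complex.I_re,
    Complex.I_im, mul_zero, sub_zero, add_zero, Complex.add_im, Complex.mul_im,
    mul_one, zero_add] at h1 h2
  norm_cast at h1 h2
  rw [Int.abs_lt_one_iff] at h1 h2
  simp [h1, h2]

end Torus

/-! ### Lifting convex sets of the plane to the surface. -/

namespace Origami

variable (X : Origami.{u})

/-- Points over `0` are isolated in the fibre. -/
theorem exists_isolating_nhds {x : X.carrier} (hx : X.proj x = 0) :
    ∃ N : Set X.carrier, IsOpen N ∧ x ∈ N ∧ ∀ y ∈ N, X.proj y = 0 → y = x := by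
  obtain ⟨k, hk, φ, E, hxs, h0, hφ⟩ := X.ramified x hx
  have hc : ContinuousAt (fun y => ‖E (φ y ^ k)‖) x :=
    ((E.continuous.continuousAt.comp ((φ.continuousAt hxs).pow k))).norm
  have h1 : ∀ᶠ y in 𝓝 x, ‖E (φ y ^ k)‖ < 1 := by
    apply hc.eventually_lt_const
    simp [h0, (by lia : k ≠ 0)]
  obtain ⟨N, hN, hNo, hxN⟩ := eventually_nhds_iff.1 (h1.and (φ.open_source.mem_nhds hxs))
  refine ⟨N, hNo, hxN, fun y hy hy0 => ?_⟩
  obtain ⟨h2, h3⟩ := hN y hy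
  have h4 := hφ y h3
  rw [hy0, hx, zero_add] at h4
  have h5 := Torus.eq_zero_of_mk_eq_zero h4.symm h2
  have h6 : φ y ^ k = 0 := by simpa using h5
  have h7 : φ y = 0 := by simpa using (pow_eq_zero_iff (by lia)).1 h6
  exact φ.injOn h3 hxs (h7.trans h0.symm)

/-- Lifting of convex sets which contain no lattice point. -/
theorem exists_lift {K : Set ℂ} (hK : Convex ℝ K) (h0 : ∀ z ∈ K, Torus.mk z ≠ 0) {z₀ : ℂ}
    (hz₀ : z₀ ∈ K) {x : X.carrier} (hx : X.proj x = Torus.mk z₀) :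
    ∃ g : ℂ → X.carrier, ContinuousOn g K ∧ (∀ z ∈ K, X.proj (g z) = Torus.mk z) ∧ g z₀ = x := by
  classical
  have := hK.contractibleSpace ⟨z₀, hz₀⟩
  have := hK.locallyPathConnectedSpace
  obtain ⟨F, ⟨hF1, hF2⟩, -⟩ := X.isCoveringMapOn.existsUnique_continuousMap_lifts
    (⟨fun z : K => Torus.mk z, Torus.continuous_mk.comp continuous_subtype_val⟩ : C(K, Torus))
    (a₀ := ⟨z₀, hz₀⟩) (e₀ := x) hx (fun a => h0 a a.2)
  refine ⟨fun z => if h : z ∈ K then F ⟨z, h⟩ else x, ?_, fun z hz => ?_, ?_⟩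
  · rw [continuousOn_iff_continuous_domRestrict]
    convert F.continuous using 1
    ext z
    simp [Set.domRestrict]
  · simpa [hz] using congrFun hF2 ⟨z, hz⟩
  · simpa [hz₀] using hF1

/-- Uniqueness of lifts on convex sets which contain no lattice point. -/
theorem eqOn_of_lifts {K : Set ℂ} (hK : Convex ℝ K) (h0 : ∀ z ∈ K, Torus.mk z ≠ 0)
    {f g : ℂ → X.carrier} (hf : ContinuousOn f K) (hg : ContinuousOn g K)
    (h : ∀ z ∈ K, X.proj (f z) = X.proj (g z)) (hp : ∀ z ∈ K, X.proj (f z) = Torus.mk z)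
    {z₀ : ℂ} (hz₀ : z₀ ∈ K) (he : f z₀ = g z₀) : Set.EqOn f g K := by
  have := hK.contractibleSpace ⟨z₀, hz₀⟩
  have := hK.locallyPathConnectedSpace
  have key := (X.isCoveringMapOn.existsUnique_continuousMap_lifts
    (⟨fun z : K => Torus.mk z, Torus.continuous_mk.comp continuous_subtype_val⟩ : C(K, Torus))
    (a₀ := ⟨z₀, hz₀⟩) (e₀ := f z₀) (hp _ hz₀) (fun a => h0 a a.2)).unique
    (y₁ := ⟨K.domRestrict f, hf.domRestrict⟩) (y₂ := ⟨K.domRestrict g, hg.domRestrict⟩)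
    ⟨rfl, funext fun z => hp z z.2⟩ ⟨he.symm, funext fun z => (h z z.2).symm.trans (hp z z.2)⟩
  intro z hz
  exact congrArg (fun F : C(K, X.carrier) => F ⟨z, hz⟩) key

/-- A lift over a convex set has a limit at every lattice point of the closure. -/
theorem exists_tendsto_lift {K : Set ℂ} (hK : Convex ℝ K)
    {g : ℂ → X.carrier} (hg : ContinuousOn g K) (hp : ∀ z ∈ K, X.proj (g z) = Torus.mk z)
    {c : ℂ} (hc : c ∈ closure K) (hc0 : Torus.mk c = 0) :
    ∃ x, X.proj x = 0 ∧ Tendsto g (𝓝[K] c) (𝓝 x) := by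
  have hne : (𝓝[K] c).NeBot := mem_closure_iff_nhdsWithin_neBot.1 hc
  obtain ⟨x, hx⟩ := exists_clusterPt_of_compactSpace (map g (𝓝[K] c))
  have hlim : Tendsto (fun z => X.proj (g z)) (𝓝[K] c) (𝓝 0) := by
    rw [← hc0]
    refine (Torus.continuous_mk.continuousAt.mono_left nhdsWithin_le_nhds).congr' ?_
    filter_upwards [self_mem_nhdsWithin] with z hz using (hp z hz).symm
  have hx0 : X.proj x = 0 := by
    have h1 : ClusterPt (X.proj x) (map X.proj (map g (𝓝[K] c))) :=
      hx.map X.continuous_proj.continuousAt tendsto_map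
    have h2 : ClusterPt (X.proj x) (𝓝 (0 : Torus)) := h1.mono hlim
    exact (eq_of_nhds_neBot h2)
  refine ⟨x, hx0, ?_⟩
  obtain ⟨N, hNo, hxN, hN⟩ := X.exists_isolating_nhds hx0
  rw [tendsto_nhds]
  intro W hW hxW
  obtain ⟨V, hVo, hxV, hV⟩ : ∃ V, IsOpen V ∧ x ∈ V ∧ closure V ⊆ N ∩ W := by
    obtain ⟨V, ⟨h1, h2⟩, h3⟩ := (Filter.HasBasis.mem_iff (hasBasis_opens_closure x)).1
      ((hNo.inter hW).mem_nhds ⟨hxN, hxW⟩)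
    exact ⟨V, h2, h1, h3⟩
  -- The frontier of V is compact and its projection misses 0, so near c the lift avoids it. The
  -- image of a small convex piece of K is connected and meets V, hence stays in V.
  have hfr : IsCompact (X.proj '' frontier V) := isClosed_frontier.isCompact.image X.continuous_proj
  have h0fr : (0 : Torus) ∉ X.proj '' frontier V := by
    rintro ⟨y, hy, hy0⟩
    have hyx := hN y (hV (frontier_subset_closure hy)).1 hy0
    rw [hVo.frontier_eq, hyx] at hy
    exact hy.2 hxV
  have hev : ∀ᶠ z in 𝓝 c, Torus.mk z ∉ X.proj '' frontier V := by
    have := hfr.isClosed.isOpen_compl.mem_nhds h0fr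
    rw [← hc0] at this
    exact Torus.continuous_mk.continuousAt this
  obtain ⟨r, hr, hball⟩ := Metric.eventually_nhds_iff_ball.1 hev
  have hconn : IsPreconnected (g '' (Metric.ball c r ∩ K)) :=
    ((convex_ball c r).inter hK).isPreconnected.image _ (hg.mono Set.inter_subset_right)
  have hmem : Metric.ball c r ∩ K ∈ 𝓝[K] c :=
    inter_mem (mem_nhdsWithin_of_mem_nhds (Metric.ball_mem_nhds c hr)) self_mem_nhdsWithin
  have hsub : g '' (Metric.ball c r ∩ K) ⊆ V ∪ (closure V)ᶜ := by
    rintro _ ⟨z, ⟨hz1, hz2⟩, rfl⟩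
    by_contra h
    simp only [Set.mem_union, Set.mem_compl_iff, not_or, not_not] at h
    exact hball z hz1 ⟨g z, by rw [hVo.frontier_eq]; exact ⟨h.2, h.1⟩, hp z hz2⟩
  have hmeet : (g '' (Metric.ball c r ∩ K) ∩ V).Nonempty := by
    have := clusterPt_iff_nonempty.1 hx (hVo.mem_nhds hxV) (image_mem_map hmem)
    rwa [Set.inter_comm] at this
  have hin := hconn.subset_left_of_subset_union hVo isClosed_closure.isOpen_compl
    (Set.disjoint_compl_right_iff_subset.2 subset_closure) hsub hmeet
  filter_upwards [hmem] with z hz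
  exact (hV (subset_closure (hin ⟨z, hz, rfl⟩))).2

/-- Lifting of convex sets, extended to lattice points of the closure. -/
theorem exists_lift_closure {K L : Set ℂ} (hK : Convex ℝ K) (h0 : ∀ z ∈ K, Torus.mk z ≠ 0)
    (hL : L ⊆ closure K) (hL0 : ∀ z ∈ L, z ∉ K → Torus.mk z = 0)
    {z₀ : ℂ} (hz₀ : z₀ ∈ K) {x : X.carrier} (hx : X.proj x = Torus.mk z₀) :
    ∃ g : ℂ → X.carrier, ContinuousOn g L ∧ (∀ z ∈ L, X.proj (g z) = Torus.mk z) ∧ g z₀ = x := by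
  obtain ⟨g, hg, hp, hgx⟩ := X.exists_lift hK h0 hz₀ hx
  have hlim : ∀ z ∈ L, ∃ y, Tendsto g (𝓝[K] z) (𝓝 y) := by
    intro z hz
    by_cases hzK : z ∈ K
    · exact ⟨g z, hg z hzK⟩
    · obtain ⟨y, -, hy⟩ := X.exists_tendsto_lift hK hg hp (hL hz) (hL0 z hz hzK)
      exact ⟨y, hy⟩
  have hext : ∀ z ∈ K, extendFrom K g z = g z := fun z hz =>
    extendFrom_eq (subset_closure hz) (hg z hz)
  refine ⟨extendFrom K g, continuousOn_extendFrom hL hlim, fun z hz => ?_, by rw [hext _ hz₀, hgx]⟩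
  by_cases hzK : z ∈ K
  · rw [hext z hzK, hp z hzK]
  · obtain ⟨y, hy0, hy⟩ := X.exists_tendsto_lift hK hg hp (hL hz) (hL0 z hz hzK)
    rw [extendFrom_eq (hL hz) hy, hy0, hL0 z hz hzK]

end Origami

/-! ### The unit square and the squares of the surface. -/

namespace Origami

variable (X : Origami.{u})

/-- Uniqueness of lifts, extended to limit points. -/
theorem eqOn_closure_of_lifts {K L : Set ℂ} (hK : Convex ℝ K) (h0 : ∀ z ∈ K, Torus.mk z ≠ 0)
    (hKL : K ⊆ L) (hLK : L ⊆ closure K)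
    {f g : ℂ → X.carrier} (hf : ContinuousOn f L) (hg : ContinuousOn g L)
    (hpf : ∀ z ∈ K, X.proj (f z) = Torus.mk z) (hpg : ∀ z ∈ K, X.proj (g z) = Torus.mk z)
    {z₀ : ℂ} (hz₀ : z₀ ∈ K) (he : f z₀ = g z₀) : Set.EqOn f g L :=
  (X.eqOn_of_lifts hK h0 (hf.mono hKL) (hg.mono hKL)
    (fun z hz => (hpf z hz).trans (hpg z hz).symm) hpf hz₀ he).of_subset_closure hf hg hKL hLK

/-- The closed unit square. -/
def unitSquare : Set ℂ := {z | (0 ≤ z.re ∧ z.re ≤ 1) ∧ 0 ≤ z.im ∧ z.im ≤ 1}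

/-- The closed unit square without its vertices. -/
def puncturedSquare : Set ℂ := {z | z ∈ unitSquare ∧ Torus.mk z ≠ 0}

theorem convex_unitSquare : Convex ℝ unitSquare := by
  intro z hz w hw a b ha hb hab
  simp only [unitSquare, Set.mem_ofPred_eq, Complex.add_re, Complex.add_im, Complex.real_smul,
    Complex.re_ofReal_mul, Complex.im_ofReal_mul] at *
  obtain ⟨⟨h1, h2⟩, h3, h4⟩ := hz
  obtain ⟨⟨k1, k2⟩, k3, k4⟩ := hw
  refine ⟨⟨by positivity, ?_⟩, by positivity, ?_⟩ <;> nlinarith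

theorem vertex_of_mem_unitSquare {z : ℂ} (hz : z ∈ unitSquare) (h : Torus.mk z = 0) :
    (z.re = 0 ∨ z.re = 1) ∧ (z.im = 0 ∨ z.im = 1) := by
  obtain ⟨⟨h1, h2⟩, h3, h4⟩ := hz
  constructor
  · by_contra! hne
    exact Torus.mk_ne_zero_of_re (lt_of_le_of_ne h1 hne.1.symm) (lt_of_le_of_ne h2 hne.2) h
  · by_contra! hne
    exact Torus.mk_ne_zero_of_im (lt_of_le_of_ne h3 hne.1.symm) (lt_of_le_of_ne h4 hne.2) h

/-- The vertices are extreme points of the square, so removing them keeps convexity. Lifting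
therefore applies to the whole punctured square at once, edges included. -/
theorem convex_puncturedSquare : Convex ℝ puncturedSquare := by
  intro z hz w hw a b ha hb hab
  rcases ha.eq_or_lt with rfl | ha
  · obtain rfl : b = 1 := by linarith
    simpa using hw
  rcases hb.eq_or_lt with rfl | hb
  · obtain rfl : a = 1 := by linarith
    simpa using hz
  have hmem := convex_unitSquare hz.1 hw.1 ha.le hb.le hab
  refine ⟨hmem, fun h0 => hz.2 ?_⟩
  have hv := vertex_of_mem_unitSquare hmem h0
  simp only [Complex.add_re, Complex.add_im, Complex.real_smul,
    Complex.re_ofReal_mul, Complex.im_ofReal_mul] at hv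
  have aux : ∀ x y : ℝ, 0 ≤ x → x ≤ 1 → 0 ≤ y → y ≤ 1 → (a * x + b * y = 0 ∨ a * x + b * y = 1) →
      x = y := by
    intro x y h1 h2 h3 h4 h
    rcases h with h | h
    · have hx : a * x = 0 := by nlinarith [mul_nonneg ha.le h1, mul_nonneg hb.le h3]
      have hy : b * y = 0 := by nlinarith [mul_nonneg ha.le h1, mul_nonneg hb.le h3]
      rw [(mul_eq_zero.1 hx).resolve_left ha.ne', (mul_eq_zero.1 hy).resolve_left hb.ne']
    · have hx : a * (1 - x) = 0 := by
        nlinarith [mul_nonneg ha.le (sub_nonneg.2 h2), mul_nonneg hb.le (sub_nonneg.2 h4)]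
      have hy : b * (1 - y) = 0 := by
        nlinarith [mul_nonneg ha.le (sub_nonneg.2 h2), mul_nonneg hb.le (sub_nonneg.2 h4)]
      have h5 := (mul_eq_zero.1 hx).resolve_left ha.ne'
      have h6 := (mul_eq_zero.1 hy).resolve_left hb.ne'
      linarith
  obtain ⟨⟨h1, h2⟩, h3, h4⟩ := hz.1
  obtain ⟨⟨k1, k2⟩, k3, k4⟩ := hw.1
  have hzw : z = w := Complex.ext (aux _ _ h1 h2 k1 k2 hv.1) (aux _ _ h3 h4 k3 k4 hv.2)
  rw [← hzw, ← add_smul, hab, one_smul] at h0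
  exact h0

/-- The centre of the unit square. -/
noncomputable def center : ℂ := 1 / 2 + 1 / 2 * Complex.I

theorem center_re : center.re = 1 / 2 := by simp [center]

theorem center_im : center.im = 1 / 2 := by simp [center]

theorem smul_center_mem {t : ℝ} (h0 : 0 < t) (h1 : t ≤ 1) : t • center ∈ puncturedSquare := by
  refine ⟨?_, Torus.mk_ne_zero_of_re ?_ ?_⟩ <;>
    simp only [unitSquare, Set.mem_ofPred_eq, Complex.real_smul, Complex.re_ofReal_mul,
      Complex.im_ofReal_mul, center_re, center_im]
  · refine ⟨⟨?_, ?_⟩, ?_, ?_⟩ <;> linarith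
  · linarith
  · linarith

theorem center_mem : center ∈ puncturedSquare := by
  simpa using smul_center_mem one_pos le_rfl

theorem unitSquare_subset_closure : unitSquare ⊆ closure puncturedSquare := by
  intro z hz
  have hlim : Tendsto (fun t : ℝ => (1 - t) • z + t • center) (𝓝[>] 0) (𝓝 z) := by
    have : Continuous fun t : ℝ => (1 - t) • z + t • center := by fun_prop
    have h := this.tendsto 0
    simp only [sub_zero, one_smul, zero_smul, add_zero] at h
    exact h.mono_left nhdsWithin_le_nhds
  refine mem_closure_of_tendsto hlim ?_
  filter_upwards [Ioo_mem_nhdsGT (zero_lt_one (α := ℝ))] with t ht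
  refine ⟨convex_unitSquare hz center_mem.1 (by linarith [ht.2]) ht.1.le (by ring), ?_⟩
  obtain ⟨⟨h1, h2⟩, h3, h4⟩ := hz
  apply Torus.mk_ne_zero_of_re <;>
    simp only [Complex.add_re, Complex.real_smul, Complex.re_ofReal_mul, center_re] <;>
    nlinarith [ht.1, ht.2]

/-- A lift of the closed unit square to the surface. -/
structure IsSquareLift (g : ℂ → X.carrier) : Prop where
  continuousOn : ContinuousOn g unitSquare
  proj : ∀ z ∈ unitSquare, X.proj (g z) = Torus.mk z

theorem exists_squareLift {z₀ : ℂ} (hz₀ : z₀ ∈ puncturedSquare) {x : X.carrier}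
    (hx : X.proj x = Torus.mk z₀) : ∃ g, X.IsSquareLift g ∧ g z₀ = x := by
  obtain ⟨g, h1, h2, h3⟩ := X.exists_lift_closure convex_puncturedSquare (fun z hz => hz.2)
    unitSquare_subset_closure (fun z hz hzK => by
      by_contra h
      exact hzK ⟨hz, h⟩) hz₀ hx
  exact ⟨g, ⟨h1, h2⟩, h3⟩

variable {X}

theorem IsSquareLift.eqOn {f g : ℂ → X.carrier} (hf : X.IsSquareLift f) (hg : X.IsSquareLift g)
    {z₀ : ℂ} (hz₀ : z₀ ∈ puncturedSquare) (he : f z₀ = g z₀) : Set.EqOn f g unitSquare :=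
  X.eqOn_closure_of_lifts convex_puncturedSquare (fun _ hz => hz.2) (fun _ hz => hz.1)
    unitSquare_subset_closure hf.continuousOn hg.continuousOn (fun z hz => hf.proj z hz.1)
    (fun z hz => hg.proj z hz.1) hz₀ he

variable (X)

/-- The squares of the surface, given by their centres. -/
def Square : Type u := X.proj ⁻¹' {Torus.mk (1 / 2 + 1 / 2 * Complex.I)}

variable {X}

theorem Square.exists_lift (s : X.Square) : ∃ g, X.IsSquareLift g ∧ g center = s.1 :=
  X.exists_squareLift center_mem s.2

/-- The parametrization of a square of the surface by the unit square. -/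
noncomputable def Square.param (s : X.Square) : ℂ → X.carrier := s.exists_lift.choose

theorem Square.isSquareLift_param (s : X.Square) : X.IsSquareLift s.param :=
  s.exists_lift.choose_spec.1

theorem Square.param_center (s : X.Square) : s.param center = s.1 := s.exists_lift.choose_spec.2

theorem Square.eq_of_param {s t : X.Square} {z : ℂ} (hz : z ∈ puncturedSquare)
    (h : s.param z = t.param z) : s = t := by
  have := s.isSquareLift_param.eqOn t.isSquareLift_param hz h center_mem.1
  rw [s.param_center, t.param_center] at this
  exact Subtype.ext this

theorem IsSquareLift.exists_square {g : ℂ → X.carrier} (hg : X.IsSquareLift g) :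
    ∃ s : X.Square, Set.EqOn s.param g unitSquare := by
  let s : X.Square := ⟨g center, hg.proj _ center_mem.1⟩
  exact ⟨s, s.isSquareLift_param.eqOn hg center_mem s.param_center⟩

/-- Through every point which is not over a vertex there is a square with prescribed coordinate. -/
theorem exists_square {z₀ : ℂ} (hz₀ : z₀ ∈ puncturedSquare) {x : X.carrier}
    (hx : X.proj x = Torus.mk z₀) : ∃ s : X.Square, s.param z₀ = x := by
  obtain ⟨g, hg, hgx⟩ := X.exists_squareLift hz₀ hx
  obtain ⟨s, hs⟩ := hg.exists_square
  exact ⟨s, by rw [hs hz₀.1, hgx]⟩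

/-- The fibres over all points of the torus other than `0` have the same cardinality. -/
theorem card_fiber {z₀ : ℂ} (hz₀ : z₀ ∈ puncturedSquare) :
    Nat.card (X.proj ⁻¹' {Torus.mk z₀}) = X.numSquares := by
  symm
  refine Nat.card_eq_of_bijective (α := X.Square)
    (fun s => ⟨s.param z₀, s.isSquareLift_param.proj z₀ hz₀.1⟩) ⟨fun s t h => ?_, fun x => ?_⟩
  · exact Square.eq_of_param hz₀ (congrArg Subtype.val h)
  · obtain ⟨s, hs⟩ := exists_square hz₀ x.2
    exact ⟨s, Subtype.ext hs⟩

/-! ### Adjacency of squares. -/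

/-- Gluing along an edge: every square has a neighbour, and it is determined by that neighbour. -/
theorem exists_neighbour {K L : Set ℂ} (w : ℂ) (hw : Torus.mk w = 0) (hK : Convex ℝ K)
    (hKp : K ⊆ puncturedSquare) (hKL : K ⊆ L) (hLK : L ⊆ closure K) (hL : L ⊆ unitSquare)
    (hLw : ∀ z ∈ L, z + w ∈ unitSquare) {z₀ : ℂ} (hz₀ : z₀ ∈ K) :
    ∃ h : X.Square → X.Square, Function.Injective h ∧
      ∀ s, ∀ z ∈ L, (h s).param z = s.param (z + w) := by
  have hmk : ∀ z, Torus.mk (z + w) = Torus.mk z := fun z => by rw [Torus.mk_add, hw, add_zero]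
  have key : ∀ s : X.Square, ∃ t : X.Square, ∀ z ∈ L, t.param z = s.param (z + w) := by
    intro s
    -- Translation by the lattice vector w does not change the projection, so the edge of t and the
    -- translated edge of s lift the same segment. Agreement at one interior point spreads to the
    -- edge and then to its end vertices.
    obtain ⟨t, ht⟩ := exists_square (X := X) (hKp hz₀) (x := s.param (z₀ + w))
      (by rw [s.isSquareLift_param.proj _ (hLw _ (hKL hz₀)), hmk])
    refine ⟨t, X.eqOn_closure_of_lifts hK (fun z hz => (hKp hz).2) hKL hLK
      (t.isSquareLift_param.continuousOn.mono hL)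
      (s.isSquareLift_param.continuousOn.comp (by fun_prop) hLw)
      (fun z hz => t.isSquareLift_param.proj z (hKp hz).1)
      (fun z hz => ?_) hz₀ ht⟩
    rw [s.isSquareLift_param.proj _ (hLw _ (hKL hz)), hmk]
  choose h hh using key
  refine ⟨h, fun s t hst => ?_, hh⟩
  have h1 := (hh s z₀ (hKL hz₀)).symm.trans ((congrArg (fun r => Square.param r z₀) hst).trans
    (hh t z₀ (hKL hz₀)))
  exact Square.eq_of_param ⟨hLw _ (hKL hz₀), by rw [hmk]; exact (hKp hz₀).2⟩ h1

/-- Both ends of the glued edge are recorded: the lower one serves horizontal saddle connections,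
the upper one identifies the far corner of a diagonal in `triangle_mem_hol`. -/
theorem exists_right : ∃ h : X.Square → X.Square, Function.Injective h ∧
    ∀ s, (h s).param 0 = s.param 1 ∧ (h s).param Complex.I = s.param (1 + Complex.I) := by
  obtain ⟨h, hi, hh⟩ : ∃ h : X.Square → X.Square, Function.Injective h ∧ ∀ s : X.Square,
      ∀ z ∈ ({z | z.re = 0 ∧ 0 ≤ z.im ∧ z.im ≤ 1} : Set ℂ), (h s).param z = s.param (z + 1) := by
    refine exists_neighbour (K := {z | z.re = 0 ∧ 0 < z.im ∧ z.im < 1}) 1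
      (by simpa using Torus.mk_int 1 0) ?_ ?_ ?_ ?_ ?_ ?_ (z₀ := Complex.I / 2)
      ⟨by simp, by simp, by simp; norm_num⟩
    · intro z hz w hw a b ha hb hab
      simp only [Set.mem_ofPred_eq, Complex.add_re, Complex.add_im, Complex.real_smul,
        Complex.re_ofReal_mul, Complex.im_ofReal_mul] at *
      refine ⟨by rw [hz.1, hw.1]; simp, ?_, ?_⟩
      · exact (convex_Ioi (𝕜 := ℝ) (0 : ℝ)) hz.2.1 hw.2.1 ha hb hab
      · exact (convex_Iio (𝕜 := ℝ) (1 : ℝ)) hz.2.2 hw.2.2 ha hb hab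
    · rintro z ⟨h1, h2, h3⟩
      exact ⟨⟨⟨h1.ge, by rw [h1]; exact zero_le_one⟩, h2.le, h3.le⟩, Torus.mk_ne_zero_of_im h2 h3⟩
    · rintro z ⟨h1, h2, h3⟩
      exact ⟨h1, h2.le, h3.le⟩
    · rintro z ⟨h1, h2, h3⟩
      have hlim : Tendsto (fun t : ℝ => (1 - t) • z + t • (Complex.I / 2)) (𝓝[>] 0) (𝓝 z) := by
        have : Continuous fun t : ℝ => (1 - t) • z + t • (Complex.I / 2) := by fun_prop
        have h := this.tendsto 0
        simp only [sub_zero, one_smul, zero_smul, add_zero] at h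
        exact h.mono_left nhdsWithin_le_nhds
      refine mem_closure_of_tendsto hlim ?_
      filter_upwards [Ioo_mem_nhdsGT (zero_lt_one (α := ℝ))] with t ht
      have e1 : (Complex.I / 2).re = 0 := by simp
      have e2 : (Complex.I / 2).im = 1 / 2 := by simp
      simp only [Complex.add_re, Complex.add_im, Complex.real_smul,
        Complex.re_ofReal_mul, Complex.im_ofReal_mul, h1, e1, e2]
      refine ⟨by simp, ?_, ?_⟩ <;> nlinarith [ht.1, ht.2]
    · rintro z ⟨h1, h2, h3⟩
      exact ⟨⟨h1.ge, by rw [h1]; exact zero_le_one⟩, h2, h3⟩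
    · rintro z ⟨h1, h2, h3⟩
      simp [unitSquare, h1, h2, h3]
  refine ⟨h, hi, fun s => ⟨?_, ?_⟩⟩
  · simpa using hh s 0 (by simp)
  · rw [hh s Complex.I (by simp), add_comm]

theorem exists_upper : ∃ h : X.Square → X.Square, Function.Injective h ∧
    ∀ s, (h s).param 0 = s.param Complex.I := by
  obtain ⟨h, hi, hh⟩ : ∃ h : X.Square → X.Square, Function.Injective h ∧ ∀ s : X.Square,
      ∀ z ∈ ({z | z.im = 0 ∧ 0 ≤ z.re ∧ z.re ≤ 1} : Set ℂ),
        (h s).param z = s.param (z + Complex.I) := by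
    refine exists_neighbour (K := {z | z.im = 0 ∧ 0 < z.re ∧ z.re < 1}) Complex.I
      (by simpa using Torus.mk_int 0 1) ?_ ?_ ?_ ?_ ?_ ?_ (z₀ := 1 / 2)
      ⟨by simp, by simp, by simp; norm_num⟩
    · intro z hz w hw a b ha hb hab
      simp only [Set.mem_ofPred_eq, Complex.add_re, Complex.add_im, Complex.real_smul,
        Complex.re_ofReal_mul, Complex.im_ofReal_mul] at *
      refine ⟨by rw [hz.1, hw.1]; simp, ?_, ?_⟩
      · exact (convex_Ioi (𝕜 := ℝ) (0 : ℝ)) hz.2.1 hw.2.1 ha hb hab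
      · exact (convex_Iio (𝕜 := ℝ) (1 : ℝ)) hz.2.2 hw.2.2 ha hb hab
    · rintro z ⟨h1, h2, h3⟩
      exact ⟨⟨⟨h2.le, h3.le⟩, h1.ge, by rw [h1]; exact zero_le_one⟩, Torus.mk_ne_zero_of_re h2 h3⟩
    · rintro z ⟨h1, h2, h3⟩
      exact ⟨h1, h2.le, h3.le⟩
    · rintro z ⟨h1, h2, h3⟩
      have hlim : Tendsto (fun t : ℝ => (1 - t) • z + t • (1 / 2 : ℂ)) (𝓝[>] 0) (𝓝 z) := by
        have : Continuous fun t : ℝ => (1 - t) • z + t • (1 / 2 : ℂ) := by fun_prop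
        have h := this.tendsto 0
        simp only [sub_zero, one_smul, zero_smul, add_zero] at h
        exact h.mono_left nhdsWithin_le_nhds
      refine mem_closure_of_tendsto hlim ?_
      filter_upwards [Ioo_mem_nhdsGT (zero_lt_one (α := ℝ))] with t ht
      have e1 : (1 / 2 : ℂ).re = 1 / 2 := by simp
      have e2 : (1 / 2 : ℂ).im = 0 := by simp
      simp only [Complex.add_re, Complex.add_im, Complex.real_smul,
        Complex.re_ofReal_mul, Complex.im_ofReal_mul, h1, e1, e2]
      refine ⟨by simp, ?_, ?_⟩ <;> nlinarith [ht.1, ht.2]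
    · rintro z ⟨h1, h2, h3⟩
      exact ⟨⟨h2, h3⟩, h1.ge, by rw [h1]; exact zero_le_one⟩
    · rintro z ⟨h1, h2, h3⟩
      simp [unitSquare, h1, h2, h3]
  refine ⟨h, hi, fun s => ?_⟩
  simpa using hh s 0 (by simp)

end Origami

/-! ### Ramification indices and singular points. -/

/-- In the chart, w and ζw with ζ a primitive k-th root of unity have the same k-th power, and w can
be taken arbitrarily small. -/
theorem HasRamificationIndex.not_injOn {S : Type u} [TopologicalSpace S] {f : S → Torus} {x : S}
    {k : ℕ} (h : HasRamificationIndex f x k) (hk : 2 ≤ k) {N : Set S} (hN : N ∈ 𝓝 x) :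
    ¬ Set.InjOn f N := by
  obtain ⟨φ, E, hxs, h0, hφ⟩ := h
  have ht0 : (0 : ℂ) ∈ φ.target := h0 ▸ φ.map_source hxs
  have hsymm0 : φ.symm 0 = x := by rw [← h0, φ.left_inv hxs]
  have hev : ∀ᶠ w in 𝓝 (0 : ℂ), w ∈ φ.target ∧ φ.symm w ∈ N := by
    refine Filter.Eventually.and (φ.open_target.mem_nhds ht0) ?_
    have := φ.continuousAt_symm ht0
    rw [ContinuousAt, hsymm0] at this
    exact this hN
  obtain ⟨ε, hε, hball⟩ := Metric.eventually_nhds_iff_ball.1 hev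
  have hζ := Complex.isPrimitiveRoot_exp k (by lia)
  set ζ := Complex.exp (2 * Real.pi * Complex.I / k)
  have hζn : ‖ζ‖ = 1 := hζ.norm'_eq_one (by lia)
  set w : ℂ := ((ε / 2 : ℝ) : ℂ)
  have hwn : ‖w‖ = ε / 2 := by
    rw [Complex.norm_real, Real.norm_of_nonneg (by positivity)]
  have hw0 : w ≠ 0 := norm_pos_iff.1 (by rw [hwn]; positivity)
  obtain ⟨h1, h2⟩ := hball w (by rw [mem_ball_zero_iff, hwn]; linarith)
  obtain ⟨h3, h4⟩ := hball (ζ * w) (by rw [mem_ball_zero_iff, norm_mul, hζn, hwn]; linarith)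
  intro hinj
  have h5 : φ.symm w = φ.symm (ζ * w) := by
    apply hinj h2 h4
    rw [hφ _ (φ.map_target h1), hφ _ (φ.map_target h3), φ.right_inv h1, φ.right_inv h3, mul_pow,
      hζ.pow_eq_one, one_mul]
  have h6 : w = ζ * w := φ.symm.injOn h1 h3 h5
  have h7 : ζ = 1 := by
    have : (ζ - 1) * w = 0 := by linear_combination -h6
    exact sub_eq_zero.1 ((mul_eq_zero.1 this).resolve_right hw0)
  exact hζ.ne_one (by lia) h7

/-- Where the linear coordinate has norm below 1/2, two points with the same image differ there by a
lattice vector of norm below 1, which is zero. -/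
theorem HasRamificationIndex.exists_injOn {S : Type u} [TopologicalSpace S] {f : S → Torus} {x : S}
    (h : HasRamificationIndex f x 1) : ∃ N ∈ 𝓝 x, Set.InjOn f N := by
  obtain ⟨φ, E, hxs, h0, hφ⟩ := h
  have hc : ContinuousAt (fun y => ‖E (φ y)‖) x :=
    (E.continuous.continuousAt.comp (φ.continuousAt hxs)).norm
  have h1 : ∀ᶠ y in 𝓝 x, ‖E (φ y)‖ < 1 / 2 := by
    apply hc.eventually_lt_const
    simp [h0]
  refine ⟨_, h1.and (φ.open_source.mem_nhds hxs), ?_⟩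
  rintro y ⟨hy1, hy2⟩ z ⟨hz1, hz2⟩ hyz
  rw [hφ y hy2, hφ z hz2, pow_one, pow_one, add_right_inj] at hyz
  have h2 : Torus.mk (E (φ y) - E (φ z)) = 0 := by
    have := Torus.mk_add (E (φ y) - E (φ z)) (E (φ z))
    rw [sub_add_cancel, hyz] at this
    exact left_eq_add.1 (this.trans (add_comm _ _))
  have h3 := Torus.eq_zero_of_mk_eq_zero h2 (by
    have := norm_sub_le (E (φ y)) (E (φ z))
    linarith)
  exact φ.injOn hy2 hz2 (E.injective (sub_eq_zero.1 h3))

namespace Origami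

variable {X : Origami.{u}}

/-- Local injectivity separates index one from index at least two, so no point can carry both kinds
of chart. -/
theorem isSingular_iff {x₀ : X.carrier} (h3 : HasRamificationIndex X.proj x₀ 3)
    (h1 : ∀ x, x ≠ x₀ → HasRamificationIndex X.proj x 1) {x : X.carrier} :
    X.IsSingular x ↔ x = x₀ := by
  constructor
  · rintro ⟨k, hk, h⟩
    by_contra hx
    obtain ⟨N, hN, hinj⟩ := (h1 x hx).exists_injOn
    exact h.not_injOn hk hN hinj
  · rintro rfl
    exact ⟨3, by norm_num, h3⟩

theorem proj_eq_zero_of_isSingular {x : X.carrier} (hx : X.IsSingular x) : X.proj x = 0 := by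
  obtain ⟨k, hk, h⟩ := hx
  by_contra h0
  obtain ⟨e, hxe, he⟩ := X.isCoveringMapOn.isLocalHomeomorphOn x h0
  exact h.not_injOn hk (e.open_source.mem_nhds hxe) (he ▸ e.injOn)

/-- Periods of saddle connections are integral. -/
theorem exists_int_of_mem_hol {v : ℂ} (hv : v ∈ X.hol) :
    ∃ p q : ℤ, v = p + q * Complex.I := by
  obtain ⟨γ, -, h0, h1, -, hγ⟩ := hv
  have := hγ 1
  rw [proj_eq_zero_of_isSingular h0, proj_eq_zero_of_isSingular h1, zero_add] at this
  exact Torus.mk_eq_zero_iff.1 (by simpa using this.symm)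

/-- At least `k` squares have their lower left vertex at a point of cone angle `2πk`. -/
theorem exists_corners {x₀ : X.carrier} {k : ℕ} (hk : k ≠ 0)
    (h3 : HasRamificationIndex X.proj x₀ k) (hx0 : X.proj x₀ = 0) :
    ∃ c : Fin k → X.Square, Function.Injective c ∧ ∀ j, (c j).param 0 = x₀ := by
  obtain ⟨φ, E, hxs, h0, hφ⟩ := h3
  have ht0 : (0 : ℂ) ∈ φ.target := h0 ▸ φ.map_source hxs
  have hsymm0 : φ.symm 0 = x₀ := by rw [← h0, φ.left_inv hxs]
  have hζ := Complex.isPrimitiveRoot_exp k hk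
  set ζ := Complex.exp (2 * Real.pi * Complex.I / k)
  have hζn : ‖ζ‖ = 1 := hζ.norm'_eq_one hk
  -- Since a ^ k represents the centre of the square, the rays through ζ ^ j * a are the k lifts to
  -- the chart of the half-diagonal from the vertex 0. Each ray enters one square, and distinct rays
  -- enter distinct squares.
  obtain ⟨a, ha⟩ := IsAlgClosed.exists_pow_nat_eq (E.symm center) (Nat.pos_of_ne_zero hk)
  have ha0 : a ≠ 0 := by
    rintro rfl
    rw [zero_pow hk] at ha
    have : center = 0 := by simpa using ha.symm
    have h := center_re
    rw [this] at h
    norm_num at h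
  have hanorm : 0 < ‖a‖ := norm_pos_iff.2 ha0
  obtain ⟨ε, hε, hball⟩ := Metric.isOpen_iff.1 φ.open_target 0 ht0
  obtain ⟨τ, hτ0, hτ1, hτ⟩ : ∃ τ : ℝ, 0 < τ ∧ τ ≤ 1 ∧ τ * ‖a‖ < ε := by
    refine ⟨min 1 (ε / (2 * ‖a‖)), by positivity, min_le_left _ _, ?_⟩
    calc min 1 (ε / (2 * ‖a‖)) * ‖a‖ ≤ ε / (2 * ‖a‖) * ‖a‖ := by gcongr; exact min_le_right _ _
      _ = ε / 2 := by field_simp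
      _ < ε := by linarith
  have htarget : ∀ (j : Fin k) (t : ℝ), 0 ≤ t → t ≤ τ → (t : ℂ) * ζ ^ (j : ℕ) * a ∈ φ.target := by
    intro j t ht htτ
    apply hball
    rw [mem_ball_zero_iff, norm_mul, norm_mul, norm_pow, hζn, one_pow, mul_one, Complex.norm_real,
      Real.norm_of_nonneg ht]
    exact (mul_le_mul_of_nonneg_right htτ hanorm.le).trans_lt hτ
  have hproj : ∀ (j : Fin k) (t : ℝ), 0 ≤ t → t ≤ τ →
      X.proj (φ.symm ((t : ℂ) * ζ ^ (j : ℕ) * a)) = Torus.mk (t ^ k • center) := by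
    intro j t ht htτ
    have hmem := htarget j t ht htτ
    rw [hφ _ (φ.map_target hmem), φ.right_inv hmem, hx0, zero_add, mul_pow, mul_pow, ← pow_mul,
      mul_comm (j : ℕ) k, pow_mul, hζ.pow_eq_one, one_pow, mul_one, ha, ← Complex.ofReal_pow,
      ← Complex.real_smul, map_smul, ContinuousLinearEquiv.apply_symm_apply]
  have hτk : 0 < τ ^ k := by positivity
  have hτk1 : τ ^ k ≤ 1 := pow_le_one₀ hτ0.le hτ1
  have hmemK : ∀ t : ℝ, 0 < t → t ≤ τ ^ k → t • center ∈ puncturedSquare := fun t h h' =>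
    smul_center_mem h (h'.trans hτk1)
  choose c hc using fun j : Fin k => exists_square (X := X) (hmemK _ hτk le_rfl)
    (hproj j τ hτ0.le le_rfl)
  refine ⟨c, fun i j hij => ?_, fun j => ?_⟩
  · have h1 := (hc i).symm.trans ((congrArg (fun r => Square.param r _) hij).trans (hc j))
    have h2 := φ.symm.injOn (htarget i τ hτ0.le le_rfl) (htarget j τ hτ0.le le_rfl) h1
    have h3 : ζ ^ (i : ℕ) = ζ ^ (j : ℕ) := by
      have hτc : (τ : ℂ) ≠ 0 := by exact_mod_cast hτ0.ne'
      exact mul_left_cancel₀ hτc (mul_right_cancel₀ ha0 h2)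
    exact Fin.ext (hζ.pow_inj i.2 j.2 h3)
  · set K : Set ℂ := (fun t : ℝ => t • center) '' Set.Ioc 0 (τ ^ k)
    set L : Set ℂ := (fun t : ℝ => t • center) '' Set.Icc 0 (τ ^ k)
    have hlin : IsLinearMap ℝ (fun t : ℝ => t • center) :=
      ⟨fun a b => add_smul _ _ _, fun a b => by simp [mul_smul]⟩
    have hKc : Convex ℝ K := (convex_Ioc 0 (τ ^ k)).is_linear_image hlin
    have hKp : ∀ z ∈ K, z ∈ puncturedSquare := by
      rintro _ ⟨t, ht, rfl⟩
      exact hmemK t ht.1 ht.2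
    have hLs : L ⊆ unitSquare := by
      rintro _ ⟨t, ht, rfl⟩
      rcases ht.1.eq_or_lt with rfl | h
      · simp [unitSquare]
      · exact (hmemK t h ht.2).1
    have hKL : K ⊆ L := Set.image_mono Set.Ioc_subset_Icc_self
    have hLK : L ⊆ closure K := by
      refine (Set.image_mono ?_).trans (image_closure_subset_closure_image (by fun_prop))
      rw [closure_Ioc hτk.ne]
    -- This inverts t ↦ t ^ k • center for t ≥ 0, so the ray in the chart becomes a lift of the
    -- half-diagonal parametrized by its points in the plane.
    set r : ℂ → ℝ := fun z => (2 * z.re) ^ ((k : ℝ)⁻¹)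
    have hr : ∀ t : ℝ, 0 ≤ t → r (t ^ k • center) = t := by
      intro t ht
      simp only [r, Complex.real_smul, Complex.re_ofReal_mul, center_re]
      rw [show 2 * (t ^ k * (1 / 2)) = t ^ k by ring, Real.pow_rpow_inv_natCast ht hk]
    have hroot : ∀ t : ℝ, 0 ≤ t → t ≤ τ ^ k → ∃ t', 0 ≤ t' ∧ t' ≤ τ ∧ t' ^ k = t := by
      intro t h h'
      refine ⟨t ^ ((k : ℝ)⁻¹), by positivity, ?_, Real.rpow_inv_natCast_pow h hk⟩
      calc t ^ ((k : ℝ)⁻¹) ≤ (τ ^ k) ^ ((k : ℝ)⁻¹) := by gcongr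
        _ = τ := Real.pow_rpow_inv_natCast hτ0.le hk
    have hrc : Continuous r :=
      (Real.continuous_rpow_const (by positivity)).comp (by fun_prop)
    have heq := X.eqOn_closure_of_lifts hKc (fun z hz => (hKp z hz).2) hKL hLK
      (f := (c j).param) (g := fun z => φ.symm ((r z : ℂ) * ζ ^ (j : ℕ) * a))
      ((c j).isSquareLift_param.continuousOn.mono hLs) ?_
      (fun z hz => (c j).isSquareLift_param.proj z (hKp z hz).1) ?_
      (z₀ := τ ^ k • center) ⟨τ ^ k, ⟨hτk, le_rfl⟩, rfl⟩ (by rw [hc j]; simp only [hr τ hτ0.le])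
    · have := heq (x := 0) ⟨0, ⟨le_rfl, hτk.le⟩, by simp⟩
      rw [this]
      simp only [r]
      rw [Complex.zero_re, mul_zero, Real.zero_rpow (by positivity), Complex.ofReal_zero,
        zero_mul, zero_mul, hsymm0]
    · refine φ.continuousOn_symm.comp (by fun_prop) ?_
      rintro _ ⟨t, ht, rfl⟩
      obtain ⟨t', h1, h2, rfl⟩ := hroot t ht.1 ht.2
      simp only [hr t' h1]
      exact htarget j t' h1 h2
    · rintro _ ⟨t, ht, rfl⟩
      obtain ⟨t', h1, h2, rfl⟩ := hroot t ht.1.le ht.2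
      simp only [hr t' h1]
      exact hproj j t' h1 h2

end Origami

/-! ### Saddle connections found by counting squares. -/

namespace Origami

variable {X : Origami.{u}}

/-- The segment runs inside a single square and its interior avoids the vertices. Singular points
lie over 0, so none is met on the way. -/
theorem mem_hol_of_square {x₀ : X.carrier} (hx : ∀ x, X.IsSingular x ↔ x = x₀)
    (hx0 : X.proj x₀ = 0) (s : X.Square) {v : ℂ} (hv : v ≠ 0)
    (hmem : ∀ t : ℝ, 0 < t → t < 1 → (t : ℂ) * v ∈ puncturedSquare) (hv1 : v ∈ unitSquare)
    (h0 : s.param 0 = x₀) (h1 : s.param v = x₀) : v ∈ X.hol := by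
  have hsq : ∀ t : unitInterval, ((t : ℝ) : ℂ) * v ∈ unitSquare := by
    intro t
    rcases t.2.1.eq_or_lt with h | h
    · rw [← h]
      simp [unitSquare]
    rcases t.2.2.eq_or_lt with h' | h'
    · rw [h']
      simpa using hv1
    · exact (hmem _ h h').1
  refine ⟨⟨fun t => s.param ((t : ℝ) * v), ?_⟩, hv, ?_, ?_, fun t ht0 ht1 => ?_, fun t => ?_⟩
  · exact s.isSquareLift_param.continuousOn.comp_continuous (by fun_prop) hsq
  · simpa [hx] using h0
  · simpa [hx] using h1
  · intro hs
    have h2 := proj_eq_zero_of_isSingular hs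
    have h3 := hmem t ht0 ht1
    exact h3.2 ((s.isSquareLift_param.proj _ h3.1).symm.trans h2)
  · simp only [ContinuousMap.coe_mk, Set.Icc.coe_zero, Complex.ofReal_zero, zero_mul, h0, hx0,
      zero_add]
    exact s.isSquareLift_param.proj _ (hsq t)

/-- Two adjacent squares give a horizontal saddle connection of length two, if the middle vertex is
not singular. -/
theorem two_mem_hol_of_squares {x₀ : X.carrier} (hx : ∀ x, X.IsSingular x ↔ x = x₀)
    (hx0 : X.proj x₀ = 0) (s t : X.Square) (hst : t.param 0 = s.param 1)
    (h0 : s.param 0 = x₀) (h1 : t.param 1 = x₀) (hmid : t.param 0 ≠ x₀) : (2 : ℂ) ∈ X.hol := by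
  have hsq : ∀ r : ℝ, 0 ≤ r → r ≤ 1 → (r : ℂ) ∈ unitSquare := by
    intro r h h'
    simp [unitSquare, h, h']
  have hsq1 : ∀ r : unitInterval, (r : ℝ) ≤ 1 / 2 → ((2 * (r : ℝ) : ℝ) : ℂ) ∈ unitSquare :=
    fun r hr => hsq _ (by linarith [r.2.1]) (by linarith)
  have hsq2 : ∀ r : unitInterval, 1 / 2 ≤ (r : ℝ) → ((2 * (r : ℝ) - 1 : ℝ) : ℂ) ∈ unitSquare :=
    fun r hr => hsq _ (by linarith) (by linarith [r.2.2])
  set f : unitInterval → X.carrier := fun r =>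
    if (r : ℝ) ≤ 1 / 2 then s.param ((2 * (r : ℝ) : ℝ) : ℂ) else t.param ((2 * (r : ℝ) - 1 : ℝ) : ℂ)
  have hf : Continuous f := by
    refine continuous_if_le (by fun_prop) continuous_const ?_ ?_ ?_
    · exact s.isSquareLift_param.continuousOn.comp (by fun_prop) (fun r hr => hsq1 r hr)
    · exact t.isSquareLift_param.continuousOn.comp (by fun_prop) (fun r hr => hsq2 r hr)
    · intro r hr
      rw [hr]
      norm_num [hst]
  have hproj : ∀ r : unitInterval, X.proj (f r) = Torus.mk ((r : ℝ) * 2) := by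
    intro r
    simp only [f]
    split_ifs with h
    · rw [s.isSquareLift_param.proj _ (hsq1 r h)]
      congr 1
      push_cast
      ring
    · rw [t.isSquareLift_param.proj _ (hsq2 r (not_le.1 h).le)]
      have : ((r : ℝ) : ℂ) * 2 = ((2 * (r : ℝ) - 1 : ℝ) : ℂ) + ((1 : ℤ) + (0 : ℤ) * Complex.I) := by
        push_cast
        ring
      rw [this, Torus.mk_add, Torus.mk_int, add_zero]
  have hf0 : f 0 = x₀ := by simp [f, h0]
  have hf1 : f 1 = x₀ := by norm_num [f, h1]
  refine ⟨⟨f, hf⟩, two_ne_zero, ?_, ?_, fun r hr0 hr1 => ?_, fun r => ?_⟩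
  · simpa [hx] using hf0
  · simpa [hx] using hf1
  · intro hs
    rw [ContinuousMap.coe_mk] at hs
    have h2 := proj_eq_zero_of_isSingular hs
    rw [hproj] at h2
    have hr0' : (0 : ℝ) < r := hr0
    have hr1' : (r : ℝ) < 1 := hr1
    rcases lt_trichotomy (r : ℝ) (1 / 2) with h | h | h
    · exact Torus.mk_ne_zero_of_re (z := (r : ℝ) * 2) (by simp [hr0'])
        (by simp; linarith) h2
    · rw [hx] at hs
      apply hmid
      rw [hst, ← hs]
      simp only [f]
      rw [if_pos h.le, h]
      norm_num
    · have h3 : ((r : ℝ) : ℂ) * 2 = ((r : ℝ) * 2 - 1 : ℂ) + ((1 : ℤ) + (0 : ℤ) * Complex.I) := by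
        push_cast
        ring
      rw [h3, Torus.mk_add, Torus.mk_int, add_zero] at h2
      exact Torus.mk_ne_zero_of_re (z := (r : ℝ) * 2 - 1) (by simp; linarith)
        (by simp; linarith) h2
  · simp only [ContinuousMap.coe_mk, hf0, hx0, zero_add]
    exact hproj r

/-- A horizontal saddle connection has multiplicity at most two: three of the seven squares have
their lower left vertex at the singularity. -/
theorem horizontal_mem_hol (hX : X.InStratumTwo) (hn : X.numSquares = 7) :
    (1 : ℂ) ∈ X.hol ∨ (2 : ℂ) ∈ X.hol := by
  classical
  obtain ⟨x₀, h3, h1⟩ := hX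
  have hx : ∀ x, X.IsSingular x ↔ x = x₀ := fun x => isSingular_iff h3 h1
  have hx0 : X.proj x₀ = 0 := proj_eq_zero_of_isSingular ((hx x₀).2 rfl)
  have hcard : Nat.card X.Square = 7 := hn
  have : Finite X.Square := Nat.finite_of_card_ne_zero (by lia)
  have := Fintype.ofFinite X.Square
  rw [Nat.card_eq_fintype_card] at hcard
  obtain ⟨c, hc, hc0⟩ := exists_corners (by norm_num) h3 hx0
  obtain ⟨h, hi, hh⟩ := exists_right (X := X)
  set B : Finset X.Square := Finset.univ.image c
  have hB : B.card = 3 := by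
    rw [Finset.card_image_of_injective _ hc, Finset.card_univ, Fintype.card_fin]
  have hB0 : ∀ s ∈ B, s.param 0 = x₀ := by
    intro s hs
    obtain ⟨j, -, rfl⟩ := Finset.mem_image.1 hs
    exact hc0 j
  have hone : ∀ s : X.Square, s.param 0 = x₀ → (h s).param 0 = x₀ → (1 : ℂ) ∈ X.hol := by
    intro s hs hhs
    refine mem_hol_of_square hx hx0 s one_ne_zero (fun t ht0 ht1 => ?_) (by simp [unitSquare]) hs
      ((hh s).1.symm.trans hhs)
    refine ⟨by simp [unitSquare, ht0.le, ht1.le], Torus.mk_ne_zero_of_re ?_ ?_⟩ <;>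
      simpa
  by_contra! hcon
  -- An overlap of B with its first or second right neighbours gives the period 1 or 2. Without
  -- overlaps, injectivity of h produces nine distinct squares among seven.
  have hd1 : Disjoint B (B.image h) := by
    rw [Finset.disjoint_left]
    intro s hs hs'
    obtain ⟨t, ht, rfl⟩ := Finset.mem_image.1 hs'
    exact hcon.1 (hone t (hB0 t ht) (hB0 _ hs))
  have hd2 : Disjoint B ((B.image h).image h) := by
    rw [Finset.disjoint_left]
    intro s hs hs'
    obtain ⟨t', ht', rfl⟩ := Finset.mem_image.1 hs'
    obtain ⟨t, ht, rfl⟩ := Finset.mem_image.1 ht'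
    refine hcon.2 (two_mem_hol_of_squares hx hx0 t (h t) (hh t).1 (hB0 t ht)
      ((hh _).1.symm.trans (hB0 _ hs)) fun h2 => hcon.1 (hone t (hB0 t ht) h2))
  have hd3 : Disjoint (B.image h) ((B.image h).image h) := by
    rwa [Finset.disjoint_image hi]
  have hle := Finset.card_le_univ (B ∪ (B.image h ∪ (B.image h).image h))
  rw [Finset.card_union_of_disjoint (Finset.disjoint_union_right.2 ⟨hd1, hd2⟩),
    Finset.card_union_of_disjoint hd3, Finset.card_image_of_injective _ hi,
    Finset.card_image_of_injective _ hi, Finset.card_image_of_injective _ hi, hB, hcard] at hle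
  lia

/-- One of the directions `1`, `i` and `1 + i` has a saddle connection of multiplicity one. -/
theorem triangle_mem_hol (hX : X.InStratumTwo) (hn : X.numSquares = 7) :
    (1 : ℂ) ∈ X.hol ∨ Complex.I ∈ X.hol ∨ 1 + Complex.I ∈ X.hol := by
  classical
  obtain ⟨x₀, h3, h1⟩ := hX
  have hx : ∀ x, X.IsSingular x ↔ x = x₀ := fun x => isSingular_iff h3 h1
  have hx0 : X.proj x₀ = 0 := proj_eq_zero_of_isSingular ((hx x₀).2 rfl)
  have hcard : Nat.card X.Square = 7 := hn
  have : Finite X.Square := Nat.finite_of_card_ne_zero (by lia)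
  have := Fintype.ofFinite X.Square
  rw [Nat.card_eq_fintype_card] at hcard
  obtain ⟨c, hc, hc0⟩ := exists_corners (by norm_num) h3 hx0
  obtain ⟨h, hi, hh⟩ := exists_right (X := X)
  obtain ⟨v, vi, hv⟩ := exists_upper (X := X)
  set B : Finset X.Square := Finset.univ.image c
  have hB : B.card = 3 := by
    rw [Finset.card_image_of_injective _ hc, Finset.card_univ, Fintype.card_fin]
  have hB0 : ∀ s ∈ B, s.param 0 = x₀ := by
    intro s hs
    obtain ⟨j, -, rfl⟩ := Finset.mem_image.1 hs
    exact hc0 j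
  by_contra! hcon
  have hd1 : Disjoint (B.image h) B := by
    rw [Finset.disjoint_left]
    intro s hs' hs
    obtain ⟨t, ht, rfl⟩ := Finset.mem_image.1 hs'
    refine hcon.1 (mem_hol_of_square hx hx0 t one_ne_zero (fun r hr0 hr1 => ?_)
      (by simp [unitSquare]) (hB0 t ht) ((hh t).1.symm.trans (hB0 _ hs)))
    exact ⟨by simp [unitSquare, hr0.le, hr1.le],
      Torus.mk_ne_zero_of_re (by simpa) (by simpa)⟩
  -- The square above s in B has its lower left vertex at the end of the left edge of s; the square
  -- above h s has it at the end of the diagonal of s. An overlap thus gives the period i or 1 + i,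
  -- and otherwise there are 3 + 6 distinct squares.
  have hd2 : Disjoint B ((B.image h ∪ B).image v) := by
    rw [Finset.disjoint_left]
    intro s hs hs'
    obtain ⟨t, ht, rfl⟩ := Finset.mem_image.1 hs'
    rcases Finset.mem_union.1 ht with ht | ht
    · obtain ⟨r, hr, rfl⟩ := Finset.mem_image.1 ht
      refine hcon.2.2 (mem_hol_of_square hx hx0 r (fun h0 => ?_) (fun q hq0 hq1 => ?_)
        (by simp [unitSquare]) (hB0 r hr) ((hh r).2.symm.trans ((hv _).symm.trans (hB0 _ hs))))
      · simpa using congrArg Complex.re h0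
      · exact ⟨by simp [unitSquare, hq0.le, hq1.le],
          Torus.mk_ne_zero_of_re (by simpa) (by simpa)⟩
    · refine hcon.2.1 (mem_hol_of_square hx hx0 t Complex.I_ne_zero (fun q hq0 hq1 => ?_)
        (by simp [unitSquare]) (hB0 t ht) ((hv _).symm.trans (hB0 _ hs)))
      exact ⟨by simp [unitSquare, hq0.le, hq1.le],
        Torus.mk_ne_zero_of_im (by simpa) (by simpa)⟩
  have hle := Finset.card_le_univ (B ∪ (B.image h ∪ B).image v)
  rw [Finset.card_union_of_disjoint hd2, Finset.card_image_of_injective _ vi,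
    Finset.card_union_of_disjoint hd1, Finset.card_image_of_injective _ hi, hB, hcard] at hle
  lia

/-! ### Invariance under SL(2, ℤ). -/

theorem hasRamificationIndex_smul (A : Matrix.SpecialLinearGroup (Fin 2) ℤ) (x : X.carrier)
    {k : ℕ} :
    HasRamificationIndex (S := X.carrier) (A • X).proj x k ↔ HasRamificationIndex X.proj x k := by
  refine ⟨fun h => ?_, fun h => hasRamificationIndex_sl h A⟩
  have h2 := hasRamificationIndex_sl h A⁻¹
  have h3 : (fun y => Torus.sl A⁻¹ ((A • X).proj y)) = X.proj := by
    funext y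
    change Torus.sl A⁻¹ (Torus.sl A (X.proj y)) = _
    rw [← Torus.sl_mul, inv_mul_cancel, Torus.sl_one]
  exact h3 ▸ h2

theorem InStratumTwo.smul (hX : X.InStratumTwo) (A : Matrix.SpecialLinearGroup (Fin 2) ℤ) :
    (A • X).InStratumTwo := by
  obtain ⟨x₀, h3, h1⟩ := hX
  exact ⟨x₀, (hasRamificationIndex_smul (X := X) A x₀).2 h3, fun x hx =>
    (hasRamificationIndex_smul (X := X) A x).2 (h1 x hx)⟩

/-- The same path serves on both surfaces: the action changes only the projection, by a bijection of
the torus, and keeps the singular points. -/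
theorem slPlane_mem_hol_smul (A : Matrix.SpecialLinearGroup (Fin 2) ℤ) {v : ℂ} :
    Torus.slPlane A v ∈ (A • X).hol ↔ v ∈ X.hol := by
  have hinj : Function.Injective (Torus.sl A) := (Torus.slHomeo A).injective
  have hsmul : ∀ (t : ℝ), Torus.slPlane A (t * v) = t * Torus.slPlane A v := by
    intro t
    rw [← Complex.real_smul, ← Complex.real_smul, ← Torus.slPlaneEquiv_apply, map_smul,
      Torus.slPlaneEquiv_apply]
  have h0 : Torus.slPlane A v ≠ 0 ↔ v ≠ 0 := by
    rw [← Torus.slPlaneEquiv_apply]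
    simp
  have hs : ∀ x : X.carrier, (A • X).IsSingular x ↔ X.IsSingular x := fun x => by
    simp only [IsSingular, hasRamificationIndex_smul]
  refine exists_congr fun γ => ?_
  refine and_congr h0 (and_congr (hs _) (and_congr (hs _)
    (and_congr ?_ (forall_congr' fun t => ?_))))
  · exact forall_congr' fun t => imp_congr_right fun _ => imp_congr_right fun _ => not_congr (hs _)
  · rw [← hsmul, ← Torus.sl_mk]
    change Torus.sl A (X.proj (γ t)) = Torus.sl A (X.proj (γ 0)) + _ ↔ _
    rw [← Torus.sl_add, hinj.eq_iff]

theorem exists_mem_puncturedSquare {p : Torus} (hp : p ≠ 0) :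
    ∃ z ∈ puncturedSquare, Torus.mk z = p := by
  obtain ⟨⟨a⟩, ⟨b⟩⟩ := p
  have hz : Torus.mk (⟨Int.fract a, Int.fract b⟩ : ℂ) =
      ((a : UnitAddCircle), (b : UnitAddCircle)) := by
    have key : ∀ r : ℝ, ((Int.fract r : ℝ) : UnitAddCircle) = (r : UnitAddCircle) := by
      intro r
      rw [← sub_eq_zero, ← AddCircle.coe_sub, AddCircle.coe_eq_zero_iff]
      exact ⟨-⌊r⌋, by simp [← Int.self_sub_floor]⟩
    simp only [Torus.mk, key]
  refine ⟨⟨Int.fract a, Int.fract b⟩, ⟨?_, ?_⟩, hz⟩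
  · exact ⟨⟨Int.fract_nonneg a, (Int.fract_lt_one a).le⟩,
      Int.fract_nonneg b, (Int.fract_lt_one b).le⟩
  · rw [hz]
    exact hp

/-- The matrix A need not fix the centre of the square modulo ℤ², so the fibre over another nonzero
point has to be counted, which `card_fiber` permits. -/
theorem numSquares_smul (A : Matrix.SpecialLinearGroup (Fin 2) ℤ) :
    (A • X).numSquares = X.numSquares := by
  set p := Torus.sl A⁻¹ (Torus.mk center)
  have hp : Torus.sl A p = Torus.mk center := by
    rw [← Torus.sl_mul, mul_inv_cancel, Torus.sl_one]
  have hp0 : p ≠ 0 := by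
    intro h
    rw [h, Torus.sl_zero] at hp
    exact center_mem.2 hp.symm
  obtain ⟨z, hz, hzp⟩ := exists_mem_puncturedSquare hp0
  rw [← card_fiber (X := X) hz, hzp]
  have : (A • X).proj ⁻¹' {Torus.mk (1 / 2 + 1 / 2 * Complex.I)} = X.proj ⁻¹' {p} := by
    ext x
    change Torus.sl A (X.proj x) = Torus.mk center ↔ X.proj x = p
    rw [← hp]
    exact (Torus.slHomeo A).injective.eq_iff
  exact congrArg (fun S : Set X.carrier => Nat.card S) this

end Origami

/-! ### Multiplicities in rational directions. -/

namespace Torus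

theorem slPlane_int (A : Matrix.SpecialLinearGroup (Fin 2) ℤ) (p q : ℤ) :
    slPlane A (p + q * Complex.I) =
      ((A 0 0 * p + A 0 1 * q : ℤ) : ℂ) + ((A 1 0 * p + A 1 1 * q : ℤ) : ℂ) * Complex.I := by
  apply Complex.ext <;> simp [slPlane]

theorem slPlane_add (A : Matrix.SpecialLinearGroup (Fin 2) ℤ) (z w : ℂ) :
    slPlane A (z + w) = slPlane A z + slPlane A w := by
  simp only [← slPlaneEquiv_apply, map_add]

end Torus

namespace Origami

variable {X : Origami.{u}}

theorem mem_hol_inv_smul (C : Matrix.SpecialLinearGroup (Fin 2) ℤ) {w : ℂ} :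
    w ∈ (C⁻¹ • X).hol ↔ Torus.slPlane C w ∈ X.hol := by
  have h := slPlane_mem_hol_smul (X := X) C⁻¹ (v := Torus.slPlane C w)
  rwa [← Torus.slPlane_mul, inv_mul_cancel, Torus.slPlane_one] at h

/-- Saddle connections can be reversed. -/
theorem neg_mem_hol {v : ℂ} (hv : v ∈ X.hol) : -v ∈ X.hol := by
  obtain ⟨γ, h0, h1, h2, h3, h4⟩ := hv
  refine ⟨⟨fun t => γ (unitInterval.symm t), by fun_prop⟩, neg_ne_zero.2 h0, by simpa using h2,
    by simpa using h1, fun t ht0 ht1 => ?_, fun t => ?_⟩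
  · refine h3 _ ?_ ?_
    · rw [← unitInterval.symm_one]
      exact unitInterval.symm_lt_symm.2 ht1
    · rw [← unitInterval.symm_zero]
      exact unitInterval.symm_lt_symm.2 ht0
  · simp only [ContinuousMap.coe_mk, unitInterval.symm_zero]
    rw [h4 1, h4 (unitInterval.symm t), add_assoc, ← Torus.mk_add]
    congr 2
    simp only [unitInterval.coe_symm_eq, Set.Icc.coe_one]
    push_cast
    ring

theorem neg_mem_hol_iff {v : ℂ} : -v ∈ X.hol ↔ v ∈ X.hol :=
  ⟨fun h => by simpa using neg_mem_hol h, neg_mem_hol⟩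

/-- In every rational direction there is a saddle connection of multiplicity one or two. -/
theorem mem_hol_of_isCoprime (hX : X.InStratumTwo) (hn : X.numSquares = 7) {p q : ℤ}
    (hpq : IsCoprime p q) :
    (p + q * Complex.I : ℂ) ∈ X.hol ∨ 2 * (p + q * Complex.I : ℂ) ∈ X.hol := by
  obtain ⟨C, hC0, hC1⟩ := hpq.exists_SL2_col 0
  have key : ∀ k : ℤ, Torus.slPlane C k = k * (p + q * Complex.I : ℂ) := by
    intro k
    have := Torus.slPlane_int C k 0
    simp only [Int.cast_zero, zero_mul, add_zero, mul_zero, hC0, hC1] at this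
    rw [this]
    push_cast
    ring
  have h1 := key 1
  have h2 := key 2
  push_cast at h1 h2
  rw [one_mul] at h1
  rcases horizontal_mem_hol (hX.smul C⁻¹) ((numSquares_smul C⁻¹).trans hn) with h | h
  · left
    rw [← h1]
    exact (mem_hol_inv_smul C).1 h
  · right
    rw [← h2]
    exact (mem_hol_inv_smul C).1 h

/-- Three directions which are pairwise of determinant one cannot all have multiplicity two. -/
theorem mem_hol_of_det_eq_one (hX : X.InStratumTwo) (hn : X.numSquares = 7) {p q p' q' : ℤ}
    (hdet : p * q' - p' * q = 1) :
    (p + q * Complex.I : ℂ) ∈ X.hol ∨ (p' + q' * Complex.I : ℂ) ∈ X.hol ∨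
      ((p + p' : ℤ) + (q + q' : ℤ) * Complex.I : ℂ) ∈ X.hol := by
  let C : Matrix.SpecialLinearGroup (Fin 2) ℤ := ⟨!![p, p'; q, q'], by
    rw [Matrix.det_fin_two_of, hdet]⟩
  have key : ∀ k l : ℤ, Torus.slPlane C (k + l * Complex.I) =
      ((p * k + p' * l : ℤ) : ℂ) + ((q * k + q' * l : ℤ) : ℂ) * Complex.I :=
    fun k l => Torus.slPlane_int C k l
  rcases triangle_mem_hol (hX.smul C⁻¹) ((numSquares_smul C⁻¹).trans hn) with h | h | h
  · left
    have h1 := (mem_hol_inv_smul C).1 h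
    have h2 := key 1 0
    simp only [Int.cast_zero, zero_mul, add_zero, mul_zero, mul_one, Int.cast_one] at h2
    rwa [h2] at h1
  · right; left
    have h1 := (mem_hol_inv_smul C).1 h
    have h2 := key 0 1
    simp only [Int.cast_zero, one_mul, zero_add, mul_zero, mul_one, Int.cast_one] at h2
    rwa [h2] at h1
  · right; right
    have h1 := (mem_hol_inv_smul C).1 h
    have h2 := key 1 1
    simp only [one_mul, mul_one, Int.cast_one] at h2
    rwa [h2] at h1

/-- A horizontal primitive vector is ±1, and reversing a saddle connection removes the sign. -/
theorem multiplicity_one_zero_eq (Y : Origami.{u}) :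
    Y.multiplicity 1 0 = sInf {k : ℕ | 0 < k ∧ (k : ℂ) ∈ Y.hol} := by
  unfold multiplicity
  congr 1
  ext k
  constructor
  · rintro ⟨v, hv, hv0, hk, p, q, hpq, rfl⟩
    refine ⟨hk, ?_⟩
    have hq : q = 0 := by
      have : (k : ℝ) * q = 0 := by simpa using hv0
      have hk' : (k : ℝ) ≠ 0 := by exact_mod_cast hk.ne'
      exact_mod_cast (mul_eq_zero.1 this).resolve_left hk'
    subst hq
    rw [isCoprime_zero_right, Int.isUnit_iff] at hpq
    rcases hpq with rfl | rfl
    · simpa using hv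
    · rw [← neg_mem_hol_iff]
      simpa using hv
  · rintro ⟨hk, hv⟩
    exact ⟨k, hv, by simp, hk, 1, 0, isCoprime_one_left, by simp⟩

open Classical in
/-- The minimal multiplicity of the saddle connections in the direction of a primitive vector, for
a surface where all these multiplicities are at most two. -/
noncomputable def dirMult (X : Origami.{u}) (p q : ℤ) : ℕ :=
  if (p + q * Complex.I : ℂ) ∈ X.hol then 1 else 2

theorem dirMult_eq_one_iff {p q : ℤ} : X.dirMult p q = 1 ↔ (p + q * Complex.I : ℂ) ∈ X.hol := by
  unfold dirMult
  split_ifs with h <;> simp [h]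

theorem dirMult_eq_one_or_two (p q : ℤ) : X.dirMult p q = 1 ∨ X.dirMult p q = 2 := by
  unfold dirMult
  split_ifs <;> simp

theorem dirMult_mul_mem_hol (hX : X.InStratumTwo) (hn : X.numSquares = 7) {p q : ℤ}
    (hpq : IsCoprime p q) : (X.dirMult p q : ℂ) * (p + q * Complex.I) ∈ X.hol := by
  unfold dirMult
  split_ifs with h
  · simpa using h
  · simpa using (mem_hol_of_isCoprime hX hn hpq).resolve_left h

/-- Horizontal multiplicities are at most two on every surface of the orbit, so the minimum is
decided by whether 1 is a period; transporting back by A, this asks whether p + qi is one. -/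
theorem multiplicity_smul (hX : X.InStratumTwo) (hn : X.numSquares = 7) {p q : ℤ}
    (A : Matrix.SpecialLinearGroup (Fin 2) ℤ)
    (hA : Torus.slPlane A (p + q * Complex.I) = 1 ∨ Torus.slPlane A (p + q * Complex.I) = -1) :
    (A • X).multiplicity 1 0 = X.dirMult p q := by
  have h1 : (1 : ℂ) ∈ (A • X).hol ↔ (p + q * Complex.I : ℂ) ∈ X.hol := by
    rw [← slPlane_mem_hol_smul (X := X) A]
    rcases hA with h | h
    · rw [h]
    · rw [h, neg_mem_hol_iff]
  have h12 := horizontal_mem_hol (hX.smul A) ((numSquares_smul A).trans hn)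
  rw [multiplicity_one_zero_eq]
  unfold dirMult
  split_ifs with h
  · refine le_antisymm (Nat.sInf_le ⟨one_pos, by simpa [h1] using h⟩) ?_
    exact (Nat.sInf_mem (s := {k : ℕ | 0 < k ∧ (k : ℂ) ∈ (A • X).hol})
      ⟨1, one_pos, by simpa [h1] using h⟩).1
  · rw [← h1] at h
    have h2 := h12.resolve_left h
    refine le_antisymm (Nat.sInf_le ⟨two_pos, by simpa using h2⟩) ?_
    obtain ⟨h3, h4⟩ := Nat.sInf_mem (s := {k : ℕ | 0 < k ∧ (k : ℂ) ∈ (A • X).hol})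
      ⟨2, two_pos, by simpa using h2⟩
    by_contra! hlt
    have h5 : sInf {k : ℕ | 0 < k ∧ (k : ℂ) ∈ (A • X).hol} = 1 := by lia
    rw [h5] at h4
    exact h (by simpa using h4)

theorem multiplicity_smul_eq_one_or_two (hX : X.InStratumTwo) (hn : X.numSquares = 7)
    (A : Matrix.SpecialLinearGroup (Fin 2) ℤ) :
    (A • X).multiplicity 1 0 = 1 ∨ (A • X).multiplicity 1 0 = 2 := by
  have h : Torus.slPlane A ((A⁻¹ 0 0 : ℤ) + (A⁻¹ 1 0 : ℤ) * Complex.I) = 1 := by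
    have h1 := Torus.slPlane_int A⁻¹ 1 0
    simp only [mul_one, mul_zero, add_zero, Int.cast_one, Int.cast_zero, zero_mul] at h1
    rw [← h1, ← Torus.slPlane_mul, mul_inv_cancel, Torus.slPlane_one]
  rw [multiplicity_smul hX hn A (Or.inl h)]
  exact dirMult_eq_one_or_two _ _

end Origami

/-! ### The infinite continued fraction expansion. -/

namespace CFrac

open GenContFract

section Expansion

variable {α : ℝ}

/-- Irrationality passes to fractional parts and inverses, so the expansion never stops and the
default value 0 in `entry` and `tail` is never taken. -/
theorem exists_stream (hα : Irrational α) (n : ℕ) :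
    ∃ s, IntFractPair.stream α n = some s ∧ Irrational s.fr ∧ 0 < s.fr ∧ s.fr < 1 := by
  have key : ∀ x : ℝ, Irrational x →
      Irrational (Int.fract x) ∧ 0 < Int.fract x ∧ Int.fract x < 1 := by
    intro x hx
    have h : Irrational (Int.fract x) := by
      rw [← Int.self_sub_floor]
      exact hx.sub_intCast _
    exact ⟨h, lt_of_le_of_ne (Int.fract_nonneg x) h.ne_zero.symm, Int.fract_lt_one x⟩
  induction n with
  | zero => exact ⟨_, IntFractPair.stream_zero α, key α hα⟩
  | succ n ih =>
    obtain ⟨s, hs, h1, h2, h3⟩ := ih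
    exact ⟨_, IntFractPair.stream_succ_of_some hs h2.ne', key _ h1.inv⟩

theorem tail_pos (hα : Irrational α) (n : ℕ) : 0 < tail α n := by
  obtain ⟨s, hs, -, h2, -⟩ := exists_stream hα n
  simpa [tail, hs] using h2

theorem tail_lt_one (hα : Irrational α) (n : ℕ) : tail α n < 1 := by
  obtain ⟨s, hs, -, -, h3⟩ := exists_stream hα n
  simpa [tail, hs] using h3

theorem entry_zero_add_tail (α : ℝ) : entry α 0 + tail α 0 = α := by
  simp [entry, tail, IntFractPair.stream_zero, IntFractPair.of]

theorem inv_tail (hα : Irrational α) (n : ℕ) :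
    (tail α n)⁻¹ = entry α (n + 1) + tail α (n + 1) := by
  obtain ⟨s, hs, -, h2, -⟩ := exists_stream hα n
  have h := IntFractPair.stream_succ_of_some hs h2.ne'
  simp [entry, tail, hs, h, IntFractPair.of]

theorem one_le_entry (hα : Irrational α) (n : ℕ) : 1 ≤ entry α (n + 1) := by
  have h1 : 1 < (tail α n)⁻¹ := (one_lt_inv₀ (tail_pos hα n)).2 (tail_lt_one hα n)
  rw [inv_tail hα] at h1
  have h2 := tail_lt_one hα (n + 1)
  have h3 : (0 : ℝ) < entry α (n + 1) := by linarith
  exact_mod_cast h3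

end Expansion

/-! ### Convergents and the matrices g. -/

section Convergents

/-- Numerators of the convergents, starting with the formal convergent `1 / 0`. -/
def num (a : ℕ → ℤ) : ℕ → ℤ
  | 0 => 1
  | 1 => a 0
  | n + 2 => a (n + 1) * num a (n + 1) + num a n

/-- Denominators of the convergents, starting with the formal convergent `1 / 0`. -/
def den (a : ℕ → ℤ) : ℕ → ℤ
  | 0 => 0
  | 1 => 1
  | n + 2 => a (n + 1) * den a (n + 1) + den a n

theorem num_mul_den_sub (a : ℕ → ℤ) (n : ℕ) :
    num a (n + 1) * den a n - num a n * den a (n + 1) = (-1) ^ (n + 1) := by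
  induction n with
  | zero => simp [num, den]
  | succ n ih =>
    rw [num, den, pow_succ, ← ih]
    ring

theorem num_congr {a b : ℕ → ℤ} {n : ℕ} (h : ∀ k < n, a k = b k) : num a n = num b n := by
  induction n using Nat.strong_induction_on with
  | _ n ih =>
    match n with
    | 0 => rfl
    | 1 => exact h 0 one_pos
    | n + 2 =>
      rw [num, num, h (n + 1) (by lia), ih (n + 1) (by lia) fun k hk => h k (by lia),
        ih n (by lia) fun k hk => h k (by lia)]

theorem den_congr {a b : ℕ → ℤ} {n : ℕ} (h : ∀ k < n, a k = b k) : den a n = den b n := by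
  induction n using Nat.strong_induction_on with
  | _ n ih =>
    match n with
    | 0 => rfl
    | 1 => rfl
    | n + 2 =>
      rw [den, den, h (n + 1) (by lia), ih (n + 1) (by lia) fun k hk => h k (by lia),
        ih n (by lia) fun k hk => h k (by lia)]

theorem reversed_congr {a b : ℕ → ℤ} {n : ℕ} (h : ∀ k ≤ n, a k = b k) :
    reversed a n = reversed b n := by
  induction n with
  | zero => rfl
  | succ n ih => rw [reversed, reversed, h (n + 1) le_rfl, ih fun k hk => h k (by lia)]

/-- The determinant of consecutive convergents is ±1 and is unaffected by adding i times one to the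
other; it supplies the Bézout coefficients. -/
theorem isCoprime_num_den (a : ℕ → ℤ) (n : ℕ) (i : ℤ) :
    IsCoprime (i * num a (n + 1) + num a n) (i * den a (n + 1) + den a n) := by
  have h := num_mul_den_sub a n
  have hsq : ((-1 : ℤ) ^ (n + 1)) * (-1) ^ (n + 1) = 1 := by
    rw [← mul_pow]; simp
  refine ⟨-(-1) ^ (n + 1) * den a (n + 1), (-1) ^ (n + 1) * num a (n + 1), ?_⟩
  linear_combination (-1) ^ (n + 1) * h + hsq

theorem den_pos_of {a : ℕ → ℤ} (ha : ∀ n, 1 ≤ a (n + 1)) (n : ℕ) :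
    0 ≤ den a n ∧ 1 ≤ den a (n + 1) := by
  induction n with
  | zero => simp [den]
  | succ n ih =>
    refine ⟨by lia, ?_⟩
    rw [den]
    nlinarith [ha n]

theorem den_mono_of {a : ℕ → ℤ} (ha : ∀ n, 1 ≤ a (n + 1)) (n : ℕ) : den a n ≤ den a (n + 1) := by
  cases n with
  | zero => simp [den]
  | succ n =>
    rw [den]
    nlinarith [ha n, den_pos_of ha n]

theorem le_den_of {a : ℕ → ℤ} (ha : ∀ n, 1 ≤ a (n + 1)) (n : ℕ) : (n : ℤ) ≤ den a (n + 1) := by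
  induction n with
  | zero => simp [den]
  | succ n ih =>
    cases n with
    | zero => simpa [den] using ha 0
    | succ n =>
      rw [den]
      push_cast at ih ⊢
      have h1 := den_pos_of ha n
      nlinarith [ha (n + 1)]

/-- The matrices `g(a_1, …, a_n) T^{-a_0}` map the convergents to `0` and `∞`. -/
theorem slPlane_g (a : ℕ → ℤ) (n : ℕ) :
    ∃ ε : ℤ, (ε = 1 ∨ ε = -1) ∧
      Torus.slPlane (g a n * ModularGroup.T ^ (-a 0)) (num a (n + 1) + den a (n + 1) * Complex.I) =
        ε * Complex.I ∧
      Torus.slPlane (g a n * ModularGroup.T ^ (-a 0)) (num a n + den a n * Complex.I) =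
        (((-1) ^ n * ε : ℤ) : ℂ) := by
  have hT : ∀ k p q : ℤ, Torus.slPlane (ModularGroup.T ^ k) (p + q * Complex.I) =
      ((p + k * q : ℤ) : ℂ) + q * Complex.I := by
    intro k p q
    rw [Torus.slPlane_int]
    simp [ModularGroup.coe_T_zpow]
  have hS : ∀ p q : ℤ, Torus.slPlane ModularGroup.S (p + q * Complex.I) =
      ((-q : ℤ) : ℂ) + p * Complex.I := by
    intro p q
    rw [Torus.slPlane_int]
    simp [ModularGroup.S]
  induction n with
  | zero =>
    refine ⟨1, Or.inl rfl, ?_, ?_⟩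
    · simp only [g, one_mul, num, den, hT]
      push_cast
      ring
    · simp only [g, one_mul, num, den, hT]
      push_cast
      ring
  | succ n ih =>
    obtain ⟨ε, hε, h1, h2⟩ := ih
    have hsign : ((-1 : ℤ) ^ n) = 1 ∨ ((-1 : ℤ) ^ n) = -1 := neg_one_pow_eq_or ℤ n
    have hM : ∀ z, Torus.slPlane (g a (n + 1) * ModularGroup.T ^ (-a 0)) z =
        Torus.slPlane (ModularGroup.T ^ ((-1) ^ n * a (n + 1))) (Torus.slPlane ModularGroup.S
          (Torus.slPlane (g a n * ModularGroup.T ^ (-a 0)) z)) := by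
      intro z
      rw [g, mul_assoc, mul_assoc, Torus.slPlane_mul, Torus.slPlane_mul]
    have hlin : Torus.slPlane (g a n * ModularGroup.T ^ (-a 0))
        (num a (n + 2) + den a (n + 2) * Complex.I) =
        (((-1) ^ n * ε : ℤ) : ℂ) + ((a (n + 1) * ε : ℤ) : ℂ) * Complex.I := by
      have e : (num a (n + 2) + den a (n + 2) * Complex.I : ℂ) =
          (a (n + 1) : ℝ) • (num a (n + 1) + den a (n + 1) * Complex.I : ℂ) +
            (num a n + den a n * Complex.I : ℂ) := by
        rw [num, den, Complex.real_smul]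
        push_cast
        ring
      rw [e, Torus.slPlane_add, h2, ← Torus.slPlaneEquiv_apply, map_smul, Torus.slPlaneEquiv_apply,
        h1, Complex.real_smul]
      push_cast
      ring
    refine ⟨(-1) ^ n * ε, ?_, ?_, ?_⟩
    · rcases hε with rfl | rfl <;> rcases hsign with h | h <;> simp [h]
    · rw [hM, hlin, hS, hT]
      -- The alternating sign in the exponent of T is what cancels the real part left by S.
      have h0 : -(a (n + 1) * ε) + (-1) ^ n * a (n + 1) * ((-1) ^ n * ε) = 0 := by
        rcases hsign with h | h <;> rw [h] <;> ring
      rw [h0]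
      simp
    · rw [hM, h1]
      have := hS 0 ε
      simp only [Int.cast_zero, zero_add] at this
      rw [this]
      have h3 := hT ((-1) ^ n * a (n + 1)) (-ε) 0
      simp only [Int.cast_zero, zero_mul, add_zero, mul_zero] at h3 ⊢
      rw [h3]
      congr 1
      rw [pow_succ]
      rcases hsign with h | h <;> rw [h] <;> ring

/-- `slPlane_g` brings the convergent to ±i, and one further S makes it horizontal. -/
theorem slPlane_S_mul_g (a : ℕ → ℤ) (n : ℕ) :
    Torus.slPlane (ModularGroup.S * g a n * ModularGroup.T ^ (-a 0))
        (num a (n + 1) + den a (n + 1) * Complex.I) = 1 ∨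
      Torus.slPlane (ModularGroup.S * g a n * ModularGroup.T ^ (-a 0))
        (num a (n + 1) + den a (n + 1) * Complex.I) = -1 := by
  obtain ⟨ε, hε, h, -⟩ := slPlane_g a n
  rw [mul_assoc, Torus.slPlane_mul, h]
  have hS := Torus.slPlane_int ModularGroup.S 0 ε
  simp only [Int.cast_zero, zero_add] at hS
  rw [hS]
  rcases hε with rfl | rfl <;> simp [ModularGroup.S]

end Convergents

end CFrac

/-! ### Approximation errors and the quantities D. -/

namespace CFrac

section Approximation

variable {α : ℝ}

/-- The signed error `q α - p` of a convergent. -/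
noncomputable def err (α : ℝ) (n : ℕ) : ℝ := den (entry α) n * α - num (entry α) n

theorem err_add_two (α : ℝ) (n : ℕ) :
    err α (n + 2) = entry α (n + 1) * err α (n + 1) + err α n := by
  simp only [err, num, den]
  push_cast
  ring

/-- The recursion of the errors matches the recursion of the tails in `inv_tail`; the minus sign is
the alternation of convergents around α. -/
theorem err_succ (hα : Irrational α) (n : ℕ) : err α (n + 1) = -tail α n * err α n := by
  induction n with
  | zero =>
    simp only [err, num, den]
    push_cast
    linear_combination -entry_zero_add_tail α
  | succ n ih =>
    have h := inv_tail hα n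
    have ht := (tail_pos hα n).ne'
    have h2 : err α n = -(tail α n)⁻¹ * err α (n + 1) := by
      rw [ih]
      field_simp
    rw [err_add_two, h2, h]
    ring

theorem err_eq (hα : Irrational α) (n : ℕ) :
    err α n = -(entry α (n + 1) + tail α (n + 1)) * err α (n + 1) := by
  linear_combination -err_add_two α n + err_succ hα (n + 1)

/-- The determinant identity for consecutive convergents, rewritten with errors, gives ±1; the
earlier error is then eliminated by `err_eq`. -/
theorem abs_err_mul (hα : Irrational α) (n : ℕ) :
    |err α (n + 1)| * ((entry α (n + 1) + tail α (n + 1)) * den (entry α) (n + 1) +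
      den (entry α) n) = 1 := by
  have h1 := num_mul_den_sub (entry α) n
  have h2 : (num (entry α) (n + 1) : ℝ) * den (entry α) n -
      num (entry α) n * den (entry α) (n + 1) = (-1) ^ (n + 1) := by exact_mod_cast h1
  have h3 : den (entry α) (n + 1) * err α n - den (entry α) n * err α (n + 1) = (-1) ^ (n + 1) := by
    rw [← h2, err, err]
    ring
  rw [err_eq hα n] at h3
  have hd0 : (0 : ℝ) ≤ den (entry α) n := by
    exact_mod_cast (den_pos_of (one_le_entry hα) n).1
  have hd1 : (1 : ℝ) ≤ den (entry α) (n + 1) := by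
    exact_mod_cast (den_pos_of (one_le_entry hα) n).2
  have ha : (1 : ℝ) ≤ entry α (n + 1) := by exact_mod_cast one_le_entry hα n
  have ht := tail_pos hα (n + 1)
  have hpos : 0 < (entry α (n + 1) + tail α (n + 1)) * den (entry α) (n + 1) + den (entry α) n := by
    positivity
  calc _ = |err α (n + 1) * ((entry α (n + 1) + tail α (n + 1)) * den (entry α) (n + 1) +
      den (entry α) n)| := by rw [abs_mul, abs_of_pos hpos]
    _ = |-(-1 : ℝ) ^ (n + 1)| := by
      congr 1
      linear_combination -h3
    _ = 1 := by rw [abs_neg, abs_pow, abs_neg, abs_one, one_pow]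

theorem reversed_entry (hα : Irrational α) (n : ℕ) :
    reversed (entry α) n = den (entry α) n / den (entry α) (n + 1) := by
  induction n with
  | zero => simp [reversed, den]
  | succ n ih =>
    have hd : (1 : ℝ) ≤ den (entry α) (n + 1) := by
      exact_mod_cast (den_pos_of (one_le_entry hα) n).2
    have hd2 : (1 : ℝ) ≤ den (entry α) (n + 2) := by
      exact_mod_cast (den_pos_of (one_le_entry hα) (n + 1)).2
    have h : (den (entry α) (n + 2) : ℝ) =
        entry α (n + 1) * den (entry α) (n + 1) + den (entry α) n := by
      rw [den]
      push_cast
      ring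
    have h0 : (entry α (n + 1) : ℝ) + den (entry α) n / den (entry α) (n + 1) =
        den (entry α) (n + 2) / den (entry α) (n + 1) := by
      rw [h]
      field_simp
    rw [reversed, ih, h0, one_div_div]

/-- One formula covers both branches of D: for i equal to the entry, the second summand is the
inverse of a tail, which expands into the next entry plus the next tail. -/
theorem D_eq (hα : Irrational α) (n : ℕ) {i : ℤ} (hi : 1 ≤ i) :
    D (n + 1) i α =
      den (entry α) (n + 1) / (i * den (entry α) (n + 1) + den (entry α) n : ℤ) +
        1 / (((entry α (n + 1) - i : ℤ) : ℝ) + tail α (n + 1)) := by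
  have hd1 := (den_pos_of (one_le_entry hα) n).2
  have hd0 := (den_pos_of (one_le_entry hα) n).1
  have hd1' : (1 : ℝ) ≤ den (entry α) (n + 1) := by exact_mod_cast hd1
  unfold D
  split_ifs with h
  · subst h
    rw [reversed_entry hα, sub_self, Int.cast_zero, zero_add, one_div, inv_tail hα, add_assoc]
    rfl
  · have hr : reversed (Function.update (entry α) (n + 1) i) n = reversed (entry α) n :=
      reversed_congr fun k hk => Function.update_of_ne (by lia) _ _
    have hq : (0 : ℝ) < (i * den (entry α) (n + 1) + den (entry α) n : ℤ) := by
      exact_mod_cast (by nlinarith : 0 < i * den (entry α) (n + 1) + den (entry α) n)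
    rw [reversed, hr, reversed_entry hα, Function.update_self]
    congr 1
    have h0 : (i : ℝ) + den (entry α) n / den (entry α) (n + 1) =
        (i * den (entry α) (n + 1) + den (entry α) n : ℤ) / den (entry α) (n + 1) := by
      push_cast
      field_simp
    rw [h0, one_div_div]

/-- The quantity `D(n, i, α)` is the inverse of `q |q α - p|` for the intermediate convergent. -/
theorem D_mul_eq_one (hα : Irrational α) (n : ℕ) {i : ℤ} (hi : 1 ≤ i)
    (hia : i ≤ entry α (n + 1)) :
    D (n + 1) i α * ((i * den (entry α) (n + 1) + den (entry α) n : ℤ) *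
      |(i * den (entry α) (n + 1) + den (entry α) n : ℤ) * α -
        (i * num (entry α) (n + 1) + num (entry α) n : ℤ)|) = 1 := by
  have hd1 := (den_pos_of (one_le_entry hα) n).2
  have hd0 := (den_pos_of (one_le_entry hα) n).1
  have ht := tail_pos hα (n + 1)
  have hA : 0 < ((entry α (n + 1) - i : ℤ) : ℝ) + tail α (n + 1) := by
    have : (0 : ℝ) ≤ (entry α (n + 1) - i : ℤ) := by exact_mod_cast sub_nonneg.2 hia
    linarith
  have hq : (0 : ℝ) < (i * den (entry α) (n + 1) + den (entry α) n : ℤ) := by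
    exact_mod_cast (by nlinarith : 0 < i * den (entry α) (n + 1) + den (entry α) n)
  have herr : (i * den (entry α) (n + 1) + den (entry α) n : ℤ) * α -
      (i * num (entry α) (n + 1) + num (entry α) n : ℤ) =
      -((((entry α (n + 1) - i : ℤ) : ℝ) + tail α (n + 1)) * err α (n + 1)) := by
    have h1 : (i * den (entry α) (n + 1) + den (entry α) n : ℤ) * α -
      (i * num (entry α) (n + 1) + num (entry α) n : ℤ) = i * err α (n + 1) + err α n := by
      simp only [err]
      push_cast
      ring
    rw [h1, err_eq hα n]
    push_cast
    ring
  rw [herr, abs_neg, abs_mul, abs_of_pos hA, D_eq hα n hi]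
  refine Eq.trans ?_ (abs_err_mul hα n)
  field_simp
  push_cast
  ring

theorem D_pos (hα : Irrational α) (n : ℕ) {i : ℤ} (hi : 1 ≤ i)
    (hia : i ≤ entry α (n + 1)) : 0 < D (n + 1) i α := by
  have hd1 := (den_pos_of (one_le_entry hα) n).2
  have hd0 := (den_pos_of (one_le_entry hα) n).1
  have hq : (0 : ℝ) < (i * den (entry α) (n + 1) + den (entry α) n : ℤ) := by
    exact_mod_cast (by nlinarith : 0 < i * den (entry α) (n + 1) + den (entry α) n)
  by_contra! h
  have h1 := D_mul_eq_one hα n hi hia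
  have h2 := mul_nonneg hq.le (abs_nonneg
    ((i * den (entry α) (n + 1) + den (entry α) n : ℤ) * α -
        (i * num (entry α) (n + 1) + num (entry α) n : ℤ) : ℝ))
  nlinarith [mul_nonneg (neg_nonneg.2 h) h2]

theorem entry_lt_D_entry (hα : Irrational α) (n : ℕ) :
    entry α (n + 2) < D (n + 1) (entry α (n + 1)) α := by
  rw [D, if_pos rfl, reversed_entry hα]
  have hd1 : (1 : ℝ) ≤ den (entry α) (n + 2) := by
    exact_mod_cast (den_pos_of (one_le_entry hα) (n + 1)).2
  have hd0 : (0 : ℝ) ≤ den (entry α) (n + 1) := by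
    exact_mod_cast (den_pos_of (one_le_entry hα) (n + 1)).1
  have h := tail_pos hα (n + 2)
  have : (0 : ℝ) ≤ den (entry α) (n + 1) / den (entry α) (n + 1 + 1) := by positivity
  have e : entry α (n + 1 + 1) = entry α (n + 2) := rfl
  have e' : tail α (n + 1 + 1) = tail α (n + 2) := rfl
  rw [e, e']
  linarith

/-! ### Classification of good approximations. -/

/-- Good rational approximations are convergents or intermediate convergents. -/
theorem exists_intermediate (hα : Irrational α) (N : ℕ) {p q : ℤ} (hpq : IsCoprime p q)
    (hq : den (entry α) (N + 3) ≤ q) (h : q * |q * α - p| < 1) :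
    ∃ n ≥ N, ∃ i, 1 ≤ i ∧ i ≤ entry α (n + 1) ∧
      p = i * num (entry α) (n + 1) + num (entry α) n ∧
      q = i * den (entry α) (n + 1) + den (entry α) n := by
  set a := entry α with ha_def
  have ha := one_le_entry hα
  have hmono : Monotone fun n => den a n := monotone_nat_of_le_succ (den_mono_of ha)
  have hlt : ∃ k, q < den a (k + 1) := by
    refine ⟨(q + 1).toNat, lt_of_lt_of_le ?_ (le_den_of ha _)⟩
    exact (lt_add_one q).trans_le (Int.self_le_toNat _)
  -- The bound N + 2 ≤ k leaves room: writing a convergent as the last intermediate one lowers the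
  -- index by one or two below.
  obtain ⟨k, hk2, hk1, hkN⟩ : ∃ k, q < den a (k + 2) ∧ den a (k + 1) ≤ q ∧ N + 2 ≤ k := by
    classical
    obtain ⟨k, hk⟩ : ∃ k, Nat.find hlt = k + 1 := by
      refine Nat.exists_eq_succ_of_ne_zero fun h0 => ?_
      have h1 := Nat.find_spec hlt
      rw [h0] at h1
      have h2 : den a 1 ≤ den a (N + 3) := hmono (by lia)
      simp only [zero_add] at h1
      lia
    refine ⟨k, ?_, ?_, ?_⟩
    · have := Nat.find_spec hlt
      rwa [hk] at this
    · by_contra! h1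
      exact Nat.find_min hlt (m := k) (by lia) h1
    · by_contra! h1
      have h2 := Nat.find_spec hlt
      rw [hk] at h2
      have h3 : den a (k + 1 + 1) ≤ den a (N + 3) := hmono (by lia)
      lia
  set s : ℤ := (-1) ^ (k + 1) with hs_def
  have hdet : num a (k + 1) * den a k - num a k * den a (k + 1) = s := num_mul_den_sub a k
  have hss : s * s = 1 := by rw [hs_def, ← mul_pow]; simp
  -- Two consecutive convergents form a basis of ℤ², so integral coordinates x, y come from Cramer's
  -- rule.
  obtain ⟨x, y, hp, hq'⟩ : ∃ x y : ℤ, p = x * num a (k + 1) + y * num a k ∧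
      q = x * den a (k + 1) + y * den a k := by
    refine ⟨s * (p * den a k - num a k * q), s * (num a (k + 1) * q - p * den a (k + 1)), ?_, ?_⟩
    · linear_combination (-p) * hss - s * p * hdet
    · linear_combination (-q) * hss - s * q * hdet
  have hd1 : 1 ≤ den a (k + 1) := (den_pos_of ha k).2
  have hd0 : 0 ≤ den a k := (den_pos_of ha k).1
  have hd1' : (1 : ℝ) ≤ den a (k + 1) := by exact_mod_cast hd1
  have hd0' : (0 : ℝ) ≤ den a k := by exact_mod_cast hd0
  have hdle : den a k ≤ den a (k + 1) := den_mono_of ha k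
  have hdle' : (den a k : ℝ) ≤ den a (k + 1) := by exact_mod_cast hdle
  have hqpos : 0 < q := by lia
  have ht := tail_pos hα (k + 1)
  have hak : (1 : ℝ) ≤ a (k + 1) := by exact_mod_cast ha k
  have habs := abs_err_mul hα k
  have hqr : (q : ℝ) = x * den a (k + 1) + y * den a k := by
    rw [hq']; push_cast; ring
  have hq1r : (den a (k + 1) : ℝ) ≤ q := by exact_mod_cast hk1
  set d := |err α (k + 1)| with hd_def
  have hdpos : 0 < d := by
    rcases (abs_nonneg (err α (k + 1))).eq_or_lt with h0 | h0
    · rw [hd_def, ← h0] at habs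
      simp at habs
    · exact h0
  set A : ℝ := a (k + 1) + tail α (k + 1) with hA_def
  have hA1 : 1 < A := by linarith
  have herr : |q * α - p| = |y * A - x| * d := by
    rw [hd_def, ← abs_mul, ← abs_neg]
    congr 1
    rw [hp, hq']
    have e1 := err_eq hα k
    rw [← ha_def, ← hA_def] at e1
    have e2 : err α k = den a k * α - num a k := rfl
    have e3 : err α (k + 1) = den a (k + 1) * α - num a (k + 1) := rfl
    rw [e2] at e1
    rw [e3] at e1 ⊢
    push_cast
    linear_combination -(y : ℝ) * e1
  rw [herr] at h
  -- As q is at least the denominator with index k + 1, which dominates the one with index k, such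
  -- an error would give a product of at least 1 by `abs_err_mul`. This excludes x and y of opposite
  -- signs.
  have hopp : ¬ (A + 1 ≤ |y * A - x|) := by
    intro hge
    have h1 : (den a (k + 1) : ℝ) * ((A + 1) * d) ≤ q * (|y * A - x| * d) := by gcongr
    have h2 : 1 ≤ den a (k + 1) * ((A + 1) * d) := by
      rw [← habs]
      nlinarith
    linarith
  rcases lt_trichotomy y 0 with hy | hy | hy
  · have hx : 1 ≤ x := by
      by_contra! hx
      nlinarith
    have hx' : (1 : ℝ) ≤ x := by exact_mod_cast hx
    have hy' : (y : ℝ) ≤ -1 := by exact_mod_cast (by lia : y ≤ -1)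
    refine absurd ?_ hopp
    rw [abs_sub_comm]
    refine le_trans ?_ (le_abs_self _)
    nlinarith
  · subst hy
    have hx1 : x = 1 := by
      have hu : IsUnit x := by
        refine hpq.isUnit_of_dvd' (x := x) ?_ ?_
        · exact ⟨num a (k + 1), by rw [hp]; ring⟩
        · exact ⟨den a (k + 1), by rw [hq']; ring⟩
      rcases Int.isUnit_iff.1 hu with hx | hx
      · exact hx
      · rw [hx] at hq'
        lia
    obtain ⟨l, rfl⟩ : ∃ l, k = l + 1 := ⟨k - 1, by lia⟩
    refine ⟨l, by lia, a (l + 1), ha l, le_rfl, ?_, ?_⟩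
    · rw [hp, hx1, one_mul, zero_mul, add_zero]
      rfl
    · rw [hq', hx1, one_mul, zero_mul, add_zero]
      rfl
  · rcases lt_trichotomy x 0 with hx | hx | hx
    · have hx' : (x : ℝ) ≤ -1 := by exact_mod_cast (by lia : x ≤ -1)
      have hy' : (1 : ℝ) ≤ y := by exact_mod_cast hy
      refine absurd ?_ hopp
      refine le_trans ?_ (le_abs_self _)
      nlinarith
    · subst hx
      have hy1 : y = 1 := by
        have hu : IsUnit y := by
          refine hpq.isUnit_of_dvd' (x := y) ?_ ?_
          · exact ⟨num a k, by rw [hp]; ring⟩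
          · exact ⟨den a k, by rw [hq']; ring⟩
        rcases Int.isUnit_iff.1 hu with hy1 | hy1 <;> lia
      obtain ⟨l, rfl⟩ : ∃ l, k = l + 2 := ⟨k - 2, by lia⟩
      refine ⟨l, by lia, a (l + 1), ha l, le_rfl, ?_, ?_⟩
      · rw [hp, hy1, one_mul, zero_mul, zero_add]
        rfl
      · rw [hq', hy1, one_mul, zero_mul, zero_add]
        rfl
    · have hk2' : q < a (k + 1) * den a (k + 1) + den a k := hk2
      have hxa : x < a (k + 1) := by
        by_contra! hge
        nlinarith
      rcases (by lia : y = 1 ∨ 2 ≤ y) with hy1 | hy2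
      · refine ⟨k, by lia, x, hx, hxa.le, ?_, ?_⟩
        · rw [hp, hy1, one_mul]
        · rw [hq', hy1, one_mul]
      -- For y ≥ 2 and 1 ≤ x < A − 1, both x(2A − x) ≥ A and 2(2A − x) ≥ 1 hold, so q|qα − p| is
      -- again at least 1.
      · exfalso
        have hx' : (1 : ℝ) ≤ x := by exact_mod_cast hx
        have hy2' : (2 : ℝ) ≤ y := by exact_mod_cast hy2
        have hxA : (x : ℝ) + 1 < A := by
          have : (x : ℝ) + 1 ≤ a (k + 1) := by exact_mod_cast hxa
          linarith
        have hpos : 2 * A - x ≤ |y * A - x| := by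
          refine le_trans ?_ (le_abs_self _)
          nlinarith
        have h1 : (x * den a (k + 1) + 2 * den a k) * ((2 * A - x) * d) ≤
            q * (|y * A - x| * d) := by
          rw [hqr]
          have : 0 ≤ 2 * A - x := by linarith
          gcongr
        have c1 : A ≤ x * (2 * A - x) := by nlinarith
        have c2 : 1 ≤ 2 * (2 * A - x) := by linarith
        have h2 : A * den a (k + 1) + den a k ≤
            (x * den a (k + 1) + 2 * den a k) * (2 * A - x) := by
          nlinarith
        have h3 : 1 ≤ (x * den a (k + 1) + 2 * den a k) * ((2 * A - x) * d) := by
          rw [← habs]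
          nlinarith
        linarith

/-- Small errors force large denominators. -/
theorem exists_lt_den_of_err (hα : Irrational α) (Q : ℕ) :
    ∃ δ > 0, ∀ p q : ℤ, 0 < q → |q * α - p| < δ → (Q : ℤ) ≤ q := by
  induction Q with
  | zero => exact ⟨1, one_pos, fun p q hq _ => by simpa using hq.le⟩
  | succ Q ih =>
    obtain ⟨δ, hδ, h⟩ := ih
    rcases Nat.eq_zero_or_pos Q with rfl | hQ
    · exact ⟨1, one_pos, fun p q hq _ => by push_cast; lia⟩
    have hirr : Irrational (Q * α) := hα.natCast_mul hQ.ne'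
    -- The second bound, the distance from Qα to the nearest integer, rules out the denominator Q
    -- itself.
    refine ⟨min δ |Q * α - round (Q * α)|, lt_min hδ (abs_pos.2 ?_), fun p q hq hlt => ?_⟩
    · exact sub_ne_zero.2 (hirr.ne_int _)
    · have h1 := h p q hq (hlt.trans_le (min_le_left _ _))
      rcases h1.eq_or_lt with h2 | h2
      · rw [← h2] at hlt
        have h3 := round_le (Q * α) p
        have h4 := hlt.trans_le (min_le_right _ _)
        push_cast at h4
        linarith
      · push_cast
        lia

end Approximation

end CFrac

/-! ### Multiplicities of convergents, and the lower bound 1 for the limsup. -/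

namespace Origami

open CFrac

variable {X : Origami.{u}} {α : ℝ}

/-- The multiplicity of the `i`-th intermediate convergent with index `n + 1`. -/
noncomputable def convMult (X : Origami.{u}) (α : ℝ) (n : ℕ) (i : ℤ) : ℕ :=
  X.dirMult (i * num (entry α) (n + 1) + num (entry α) n)
    (i * den (entry α) (n + 1) + den (entry α) n)

theorem convMult_entry (n : ℕ) : X.convMult α n (entry α (n + 1)) =
    X.dirMult (num (entry α) (n + 2)) (den (entry α) (n + 2)) := rfl

/-- Replacing the last entry by i turns the last convergent into the i-th intermediate one, while
the earlier convergents do not see that entry. -/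
theorem multiplicity_eq_convMult (hX : X.InStratumTwo) (hn : X.numSquares = 7) (n : ℕ) (i : ℤ) :
    ((ModularGroup.S * CFrac.g (Function.update (CFrac.entry α) (n + 1) i) (n + 1) *
      ModularGroup.T ^ (-CFrac.entry α 0)) • X).multiplicity 1 0 = X.convMult α n i := by
  have h := slPlane_S_mul_g (Function.update (entry α) (n + 1) i) (n + 1)
  have hu : ∀ k < n + 1, Function.update (entry α) (n + 1) i k = entry α k := fun k hk =>
    Function.update_of_ne (by lia) _ _
  rw [hu 0 (by lia), num, den, Function.update_self, num_congr hu, den_congr hu,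
    num_congr (n := n) fun k hk => hu k (by lia), den_congr (n := n) fun k hk => hu k (by lia)] at h
  exact multiplicity_smul hX hn _ h

theorem convMult_eq_one_or_two (n : ℕ) (i : ℤ) : X.convMult α n i = 1 ∨ X.convMult α n i = 2 :=
  dirMult_eq_one_or_two _ _

/-- Consecutive convergents of multiplicity two are separated by a vector of multiplicity one. -/
theorem dirMult_add_eq_one (hX : X.InStratumTwo) (hn : X.numSquares = 7) (a : ℕ → ℤ) (n : ℕ)
    (h0 : X.dirMult (num a n) (den a n) = 2) (h1 : X.dirMult (num a (n + 1)) (den a (n + 1)) = 2) :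
    X.dirMult (num a (n + 1) + num a n) (den a (n + 1) + den a n) = 1 := by
  have key : ∀ p q p' q' : ℤ, p * q' - p' * q = 1 → X.dirMult p q = 2 → X.dirMult p' q' = 2 →
      X.dirMult (p + p') (q + q') = 1 := by
    intro p q p' q' hdet h h'
    rw [dirMult_eq_one_iff]
    rcases mem_hol_of_det_eq_one hX hn hdet with h2 | h2 | h2
    · rw [← dirMult_eq_one_iff] at h2
      lia
    · rw [← dirMult_eq_one_iff] at h2
      lia
    · exact h2
  have hdet := num_mul_den_sub a n
  rcases neg_one_pow_eq_or ℤ (n + 1) with h | h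
  · exact key _ _ _ _ (hdet.trans h) h1 h0
  · rw [add_comm, add_comm (den a (n + 1))]
    exact key _ _ _ _ (by linarith) h0 h1

/-- The values `D / m²` exceed one infinitely often. -/
theorem frequently_one_le (hX : X.InStratumTwo) (hn : X.numSquares = 7) (hα : Irrational α)
    (N : ℕ) : ∃ n ≥ N, ∃ i, 1 ≤ i ∧ i ≤ entry α (n + 1) ∧
      1 ≤ D (n + 1) i α / (X.convMult α n i : ℝ) ^ 2 := by
  by_contra! hcon
  have ha := one_le_entry hα
  -- Take i equal to the entry: D then exceeds the next entry, which is at least 1. So multiplicity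
  -- one is impossible, and multiplicity two bounds the next entry by 3.
  have hm : ∀ n ≥ N, X.dirMult (num (entry α) (n + 2)) (den (entry α) (n + 2)) = 2 ∧
      entry α (n + 2) ≤ 3 := by
    intro n hnN
    have h1 := hcon n hnN _ (ha n) le_rfl
    have h2 := entry_lt_D_entry hα n
    have h3 : (1 : ℝ) ≤ entry α (n + 2) := by exact_mod_cast ha (n + 1)
    rcases convMult_eq_one_or_two (X := X) (α := α) n (entry α (n + 1)) with h | h
    · rw [h] at h1
      norm_num at h1
      linarith
    · refine ⟨(convMult_entry n).symm.trans h, ?_⟩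
      rw [h] at h1
      norm_num at h1
      rw [div_lt_one (by norm_num)] at h1
      have : (entry α (n + 2) : ℝ) < 4 := h2.trans h1
      have h5 : entry α (n + 2) < 4 := by exact_mod_cast this
      lia
  -- An entry 1 would make a convergent the sum of its two predecessors, both of multiplicity two,
  -- and so give it multiplicity one.
  have h2 : ∀ n ≥ N, 2 ≤ entry α (n + 3) := by
    intro n hnN
    by_contra! hlt
    have h1 : entry α (n + 3) = 1 := by
      have : 1 ≤ entry α (n + 3) := ha (n + 2)
      lia
    have h := dirMult_add_eq_one hX hn (entry α) (n + 2) (hm n hnN).1 (hm (n + 1) (by lia)).1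
    have h' := (hm (n + 2) (by lia)).1
    have e1 : num (entry α) (n + 2 + 2) = num (entry α) (n + 2 + 1) + num (entry α) (n + 2) := by
      rw [num, h1, one_mul]
    have e2 : den (entry α) (n + 2 + 2) = den (entry α) (n + 2 + 1) + den (entry α) (n + 2) := by
      rw [den, h1, one_mul]
    rw [e1, e2, h] at h'
    norm_num at h'
  have hmult : X.convMult α (N + 3) 1 = 1 := by
    unfold convMult
    rw [one_mul, one_mul]
    exact dirMult_add_eq_one hX hn (entry α) (N + 3) (hm (N + 1) (by lia)).1 (hm (N + 2) (by lia)).1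
  have hD := hcon (N + 3) (by lia) 1 le_rfl (ha _)
  rw [hmult, D_eq hα _ le_rfl] at hD
  norm_num at hD
  have b1 : (2 : ℝ) ≤ entry α (N + 3) := by exact_mod_cast h2 N le_rfl
  have b2 : (2 : ℝ) ≤ entry α (N + 5) := by exact_mod_cast h2 (N + 2) (by lia)
  have b3 : (entry α (N + 4) : ℝ) ≤ 3 := by exact_mod_cast (hm (N + 2) (by lia)).2
  have b4 : (1 : ℝ) ≤ entry α (N + 4) := by exact_mod_cast ha (N + 3)
  have ht : tail α (N + 4) ≤ 1 / 2 := by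
    have h := inv_tail hα (N + 4)
    have h' := tail_pos hα (N + 5)
    have h3 : 2 ≤ (tail α (N + 4))⁻¹ := by
      rw [h]
      change (2 : ℝ) ≤ entry α (N + 5) + tail α (N + 5)
      linarith
    rw [one_div]
    exact (le_inv_comm₀ two_pos (tail_pos hα _)).1 h3
  have ht0 := tail_pos hα (N + 4)
  have hden0 : (0 : ℝ) ≤ den (entry α) (N + 2) := by exact_mod_cast (den_pos_of ha (N + 2)).1
  have hden1 : (1 : ℝ) ≤ den (entry α) (N + 3) := by exact_mod_cast (den_pos_of ha (N + 2)).2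
  have hden : (den (entry α) (N + 3 + 1) : ℝ) =
      entry α (N + 3) * den (entry α) (N + 3) + den (entry α) (N + 2) := by
    rw [den]
    push_cast
    rfl
  -- An entry at least 2 at least doubles the denominators, which gives 2/3; the next entry is at
  -- most 3 with tail at most 1/2, which gives 2/5. The sum 16/15 exceeds 1.
  have c1 : (2 / 3 : ℝ) ≤ den (entry α) (N + 3 + 1) /
      (den (entry α) (N + 3 + 1) + den (entry α) (N + 3)) := by
    rw [div_le_div_iff₀ (by norm_num) (by rw [hden]; positivity), hden]
    nlinarith
  have c2 : (2 / 5 : ℝ) ≤ (entry α (N + 3 + 1) - 1 + tail α (N + 3 + 1))⁻¹ := by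
    have e1 : entry α (N + 3 + 1) = entry α (N + 4) := rfl
    have e2 : tail α (N + 3 + 1) = tail α (N + 4) := rfl
    rw [e1, e2, le_inv_comm₀ (by norm_num) (by linarith)]
    norm_num
    linarith
  linarith

theorem dirMult_le_of_mul_mem_hol {p q : ℤ} {k : ℕ} (hk : 0 < k)
    (h : (k : ℂ) * (p + q * Complex.I) ∈ X.hol) : X.dirMult p q ≤ k := by
  rcases dirMult_eq_one_or_two (X := X) p q with h1 | h1
  · lia
  · by_contra! hlt
    obtain rfl : k = 1 := by lia
    rw [Nat.cast_one, one_mul, ← dirMult_eq_one_iff] at h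
    lia

/-! ### Periods compared with intermediate convergents. -/

/-- Upper bound for the quality of the approximations by periods. -/
theorem exists_bound_of_convMult (hα : Irrational α) (β κ : ℝ) (hκ : 0 < κ) {b b' : ℝ}
    (hb' : 1 < b') (hbb : b' < b) {N : ℕ}
    (h : ∀ n ≥ N, ∀ i, 1 ≤ i → i ≤ entry α (n + 1) →
      D (n + 1) i α / (X.convMult α n i : ℝ) ^ 2 ≤ b') :
    ∃ M : ℝ, ∀ v ∈ X.hol, M ≤ |κ * (v.im + β * (v.re - α * v.im))| →
      1 / b ≤ |v.re - α * v.im| * |v.im + β * (v.re - α * v.im)| := by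
  have hb0 : 0 < b := by linarith
  obtain ⟨δ, hδ, hδ'⟩ := exists_lt_den_of_err hα (den (entry α) (N + 3)).toNat
  -- Below η the error forces a large denominator, excludes horizontal periods, and keeps the term
  -- with β within the gap between 1/b and 1/b'.
  obtain ⟨η, hη0, hηδ, hη1, hηb⟩ : ∃ η : ℝ, 0 < η ∧ η ≤ δ ∧ η ≤ 1 ∧
      |β| * η ^ 2 < 1 / b' - 1 / b := by
    have hgap : 0 < 1 / b' - 1 / b := sub_pos.2 (one_div_lt_one_div_of_lt (by linarith) hbb)
    have hlim : Tendsto (fun η : ℝ => |β| * η ^ 2) (𝓝[>] 0) (𝓝 0) := by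
      have : Continuous fun η : ℝ => |β| * η ^ 2 := by fun_prop
      have h := this.tendsto 0
      simp only [ne_eq, OfNat.ofNat_ne_zero, not_false_eq_true, zero_pow, mul_zero] at h
      exact h.mono_left nhdsWithin_le_nhds
    have h1 : ∀ᶠ η : ℝ in 𝓝[>] 0, η ∈ Set.Ioo 0 (min δ 1) :=
      Ioo_mem_nhdsGT (lt_min hδ one_pos)
    obtain ⟨η, h2, h3⟩ := ((hlim.eventually_lt_const hgap).and h1).exists
    exact ⟨η, h3.1, h3.2.le.trans (min_le_left _ _), h3.2.le.trans (min_le_right _ _), h2⟩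
  -- Dividing by the gcd k leaves an approximation with W < 1, hence an intermediate convergent of
  -- multiplicity m ≤ k. Then 1 = D·W ≤ b'm²W ≤ b'k²W < 1.
  have main : ∀ x y : ℤ, 0 < y → (x + y * Complex.I : ℂ) ∈ X.hol → |x - α * y| < η →
      |x - α * y| * |(y : ℝ)| < 1 / b' → False := by
    intro x y hy hv he hey
    obtain ⟨k, hk0, p, q, hpq, hx, hyq⟩ : ∃ k : ℕ, 0 < k ∧ ∃ p q : ℤ, IsCoprime p q ∧
        x = k * p ∧ y = k * q := by
      have hg : 0 < Int.gcd x y := Int.gcd_pos_of_ne_zero_right _ hy.ne'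
      obtain ⟨p, q, hpq, hx, hy'⟩ := Int.exists_gcd_one hg
      exact ⟨_, hg, p, q, Int.isCoprime_iff_gcd_eq_one.2 hpq, by rw [mul_comm]; exact hx,
        by rw [mul_comm]; exact hy'⟩
    have hk1 : (1 : ℝ) ≤ k := by exact_mod_cast hk0
    have hq0 : 0 < q := by
      rw [hyq] at hy
      exact pos_of_mul_pos_right hy (by positivity)
    have hq0r : (0 : ℝ) < q := by exact_mod_cast hq0
    have herr : |x - α * y| = k * |q * α - p| := by
      rw [hx, hyq]
      push_cast
      rw [← abs_neg, show -((k : ℝ) * p - α * (k * q)) = k * (q * α - p) by ring, abs_mul,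
        abs_of_pos (by linarith)]
    have hyr : |(y : ℝ)| = k * q := by
      rw [hyq]
      push_cast
      rw [abs_of_pos (by positivity)]
    have hE := abs_nonneg (q * α - p)
    have h1 : |q * α - p| < δ := by
      refine lt_of_le_of_lt ?_ (he.trans_le hηδ)
      rw [herr]
      nlinarith
    have h2 : den (entry α) (N + 3) ≤ q := by
      have := hδ' p q hq0 h1
      lia
    rw [herr, hyr] at hey
    have hqE : (q : ℝ) * |q * α - p| < 1 := by
      have : (q : ℝ) * |q * α - p| ≤ k * |q * α - p| * (k * q) := by
        have h3 : 0 ≤ q * |q * α - p| := by positivity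
        have h4 : (1 : ℝ) ≤ k * k := by nlinarith
        calc (q : ℝ) * |q * α - p| ≤ k * k * (q * |q * α - p|) := le_mul_of_one_le_left h3 h4
          _ = k * |q * α - p| * (k * q) := by ring
      have h4 : 1 / b' < 1 := by
        rw [div_lt_one (by linarith)]
        exact hb'
      linarith
    obtain ⟨n, hnN, i, hi1, hia, rfl, rfl⟩ := exists_intermediate hα N hpq h2 hqE
    have h3 := h n hnN i hi1 hia
    have h4 := D_mul_eq_one hα n hi1 hia
    have h5 := D_pos hα n hi1 hia
    have hmk : X.convMult α n i ≤ k := by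
      apply dirMult_le_of_mul_mem_hol hk0
      rw [hx, hyq] at hv
      convert hv using 1
      push_cast
      ring
    have hmk' : (X.convMult α n i : ℝ) ≤ k := by exact_mod_cast hmk
    have hm0 : (0 : ℝ) < X.convMult α n i := by
      rcases convMult_eq_one_or_two (X := X) (α := α) n i with h | h <;> rw [h] <;> norm_num
    rw [div_le_iff₀ (by positivity)] at h3
    set W : ℝ := (i * den (entry α) (n + 1) + den (entry α) n : ℤ) *
      |(i * den (entry α) (n + 1) + den (entry α) n : ℤ) * α -
        (i * num (entry α) (n + 1) + num (entry α) n : ℤ)| with hW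
    have hW0 : 0 < W := by
      by_contra! hle
      nlinarith
    have h6 : (k : ℝ) ^ 2 * W < 1 / b' := by
      refine lt_of_eq_of_lt ?_ hey
      rw [hW]
      ring
    have h7 : (X.convMult α n i : ℝ) ^ 2 ≤ (k : ℝ) ^ 2 := by gcongr
    rw [lt_div_iff₀ (by linarith)] at h6
    have h8 : D (n + 1) i α * W ≤ b' * (X.convMult α n i : ℝ) ^ 2 * W := by gcongr
    have h9 : b' * (X.convMult α n i : ℝ) ^ 2 * W ≤ b' * (k : ℝ) ^ 2 * W := by gcongr
    linarith
  -- With the rotated imaginary part this large, a product below 1/b forces an error below η.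
  refine ⟨κ * (1 / (b * η)), fun v hv hM => ?_⟩
  by_contra! hlt
  obtain ⟨x, y, rfl⟩ := exists_int_of_mem_hol hv
  have hre : (x + y * Complex.I : ℂ).re = x := by simp
  have him : (x + y * Complex.I : ℂ).im = y := by simp
  rw [hre, him] at hlt hM
  rw [abs_mul, abs_of_pos hκ] at hM
  have hM' : 1 / (b * η) ≤ |y + β * (x - α * y)| := le_of_mul_le_mul_left hM hκ
  have he : |x - α * y| < η := by
    by_contra! hge
    have : η * (1 / (b * η)) ≤ |x - α * y| * |y + β * (x - α * y)| := by gcongr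
    have e : η * (1 / (b * η)) = 1 / b := by field_simp
    linarith
  have hey : |x - α * y| * |(y : ℝ)| < 1 / b' := by
    have h1 : |(y : ℝ)| ≤ |y + β * (x - α * y)| + |β| * |x - α * y| := by
      rw [← abs_mul]
      have := abs_sub (y + β * (x - α * y)) (β * (x - α * y))
      rwa [add_sub_cancel_right] at this
    have h2 : |x - α * y| * |(y : ℝ)| ≤
        |x - α * y| * (|y + β * (x - α * y)| + |β| * |x - α * y|) := by
      gcongr
    have h3 : |β| * (|x - α * y| * |x - α * y|) ≤ |β| * η ^ 2 := by
      rw [pow_two]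
      gcongr
    nlinarith
  rcases lt_trichotomy y 0 with hy | hy | hy
  · refine main (-x) (-y) (by lia) ?_ ?_ ?_
    · have e : (((-x : ℤ) : ℂ) + ((-y : ℤ) : ℂ) * Complex.I) = -(x + y * Complex.I) := by
        push_cast
        ring
      rw [e]
      exact neg_mem_hol hv
    · push_cast
      rwa [show (-x - α * -y : ℝ) = -(x - α * y) by ring, abs_neg]
    · push_cast
      rwa [show (-x - α * -y : ℝ) = -(x - α * y) by ring, abs_neg, abs_neg]
  · subst hy
    have hx : x ≠ 0 := by
      rintro rfl
      obtain ⟨γ, h0, -⟩ := hv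
      simp at h0
    have h1 : (1 : ℝ) ≤ |(x : ℝ)| := by exact_mod_cast Int.one_le_abs hx
    simp only [Int.cast_zero, mul_zero, sub_zero] at he
    linarith
  · exact main x y hy hv he hey

/-- Lower bound for the quality of the approximations by periods. -/
theorem exists_period_of_convMult (hX : X.InStratumTwo) (hn : X.numSquares = 7)
    (hα : Irrational α) (β κ : ℝ) (hκ : 0 < κ) {b b' : ℝ} (hb : 0 < b) (hbb : b < b')
    (h : ∀ N : ℕ, ∃ n ≥ N, ∃ i, 1 ≤ i ∧ i ≤ entry α (n + 1) ∧
      b' < D (n + 1) i α / (X.convMult α n i : ℝ) ^ 2) (M : ℝ) :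
    ∃ v ∈ X.hol, M ≤ |κ * (v.im + β * (v.re - α * v.im))| ∧
      |v.re - α * v.im| * |v.im + β * (v.re - α * v.im)| ≤ 1 / b := by
  have hb'0 : 0 < b' := hb.trans hbb
  -- The denominator is at least n, so the error of the period is at most 1/(b'n). For large n the
  -- terms with β fit in the gap between 1/b' and 1/b, and the imaginary part exceeds M.
  obtain ⟨N, hN⟩ : ∃ N : ℕ, ∀ n : ℕ, N ≤ n → 0 < (n : ℝ) ∧
      |β| * (1 / (b' * n)) ^ 2 ≤ 1 / b - 1 / b' ∧ M / κ ≤ n - |β| * (1 / (b' * n)) := by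
    have hinv : Tendsto (fun n : ℕ => 1 / (b' * (n : ℝ))) atTop (𝓝 0) := by
      have h1 : Tendsto (fun n : ℕ => b' * (n : ℝ)) atTop atTop :=
        tendsto_natCast_atTop_atTop.const_mul_atTop hb'0
      simp only [one_div]
      exact h1.inv_tendsto_atTop
    have hgap : 0 < 1 / b - 1 / b' := sub_pos.2 (one_div_lt_one_div_of_lt hb hbb)
    have h1 : Tendsto (fun n : ℕ => |β| * (1 / (b' * (n : ℝ))) ^ 2) atTop (𝓝 0) := by
      simpa using (hinv.pow 2).const_mul |β|
    have h2 : Tendsto (fun n : ℕ => |β| * (1 / (b' * (n : ℝ)))) atTop (𝓝 0) := by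
      simpa using hinv.const_mul |β|
    have h3 : Tendsto (fun n : ℕ => (n : ℝ) - |β| * (1 / (b' * (n : ℝ)))) atTop atTop := by
      simpa only [sub_eq_add_neg] using tendsto_natCast_atTop_atTop.atTop_add h2.neg
    have h4 := ((eventually_gt_atTop 0).and ((h1.eventually_lt_const hgap).and
      (h3.eventually_ge_atTop (M / κ))))
    obtain ⟨N, hN⟩ := eventually_atTop.1 h4
    exact ⟨N, fun n hn => ⟨by exact_mod_cast (hN n hn).1, (hN n hn).2.1.le, (hN n hn).2.2⟩⟩
  obtain ⟨n, hnN, i, hi1, hia, hD⟩ := h N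
  obtain ⟨hn0, hn1, hn2⟩ := hN n hnN
  set p := i * num (entry α) (n + 1) + num (entry α) n with hp
  set q := i * den (entry α) (n + 1) + den (entry α) n with hq
  have hmdef : X.convMult α n i = X.dirMult p q := rfl
  set m := X.dirMult p q with hm
  rw [hmdef] at hD
  have hm1 : (1 : ℝ) ≤ m := by
    rcases dirMult_eq_one_or_two (X := X) p q with h | h <;> rw [hm, h] <;> norm_num
  have hmem := dirMult_mul_mem_hol hX hn (isCoprime_num_den (entry α) n i)
  have hDm := D_mul_eq_one hα n hi1 hia
  have hDpos := D_pos hα n hi1 hia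
  rw [← hp, ← hq] at hDm hmem
  rw [← hm] at hmem
  have ha := one_le_entry hα
  have hqn : (n : ℝ) ≤ q := by
    have h1 := le_den_of ha n
    have h2 := den_pos_of ha n
    have h3 : (n : ℤ) ≤ q := by nlinarith
    exact_mod_cast h3
  have hE := abs_nonneg (q * α - p)
  set E := |q * α - p| with hE_def
  have hq0 : (0 : ℝ) < q := hn0.trans_le hqn
  have hre : ((m : ℂ) * (p + q * Complex.I)).re = m * p := by simp
  have him : ((m : ℂ) * (p + q * Complex.I)).im = m * q := by simp
  have habs : |(m * p - α * (m * q) : ℝ)| = m * E := by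
    rw [show (m * p - α * (m * q) : ℝ) = -(m * (q * α - p)) by ring, abs_neg, abs_mul,
      abs_of_pos (by linarith)]
  have hprod : m * E * (m * q) ≤ 1 / b' := by
    rw [lt_div_iff₀ (by positivity)] at hD
    rw [le_div_iff₀ hb'0]
    have h1 : b' * (m : ℝ) ^ 2 * (q * E) ≤ D (n + 1) i α * (q * E) := by gcongr
    nlinarith
  have hmq : (n : ℝ) ≤ m * q := by nlinarith
  have hsmall : m * E ≤ 1 / (b' * n) := by
    rw [le_div_iff₀ (by positivity)]
    rw [le_div_iff₀ hb'0] at hprod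
    have : m * E * n ≤ m * E * (m * q) := by gcongr
    nlinarith
  refine ⟨_, hmem, ?_, ?_⟩
  · rw [hre, him, abs_mul, abs_of_pos hκ]
    have h1 : M / κ ≤ |m * q + β * (m * p - α * (m * q))| := by
      have h2 : |(m * q : ℝ)| - |β * (m * p - α * (m * q))| ≤
          |m * q + β * (m * p - α * (m * q))| := by
        have := abs_sub_abs_le_abs_sub (m * q : ℝ) (-(β * (m * p - α * (m * q))))
        rwa [abs_neg, sub_neg_eq_add] at this
      rw [abs_mul β, habs, abs_of_pos (by positivity)] at h2
      have h3 : |β| * (m * E) ≤ |β| * (1 / (b' * n)) := by gcongr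
      linarith
    rw [div_le_iff₀ hκ] at h1
    linarith
  · rw [hre, him]
    have h2 : |m * q + β * (m * p - α * (m * q))| ≤ m * q + |β| * (m * E) := by
      refine (abs_add_le _ _).trans ?_
      rw [abs_mul β, habs, abs_of_pos (by positivity)]
    rw [habs]
    have h3 : |β| * (m * E) ^ 2 ≤ |β| * (1 / (b' * n)) ^ 2 := by gcongr
    calc m * E * |m * q + β * (m * p - α * (m * q))| ≤ m * E * (m * q + |β| * (m * E)) := by gcongr
      _ = m * E * (m * q) + |β| * (m * E) ^ 2 := by ring
      _ ≤ 1 / b := by linarith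

end Origami

/-! ### From periods to the limsup formula. -/

namespace Origami

open CFrac

variable {X : Origami.{u}} {α : ℝ}

/-- Both coordinates are expressed through the error v.re − α v.im, so that the κ cancel in the
product and only the factor 1/7 from the area remains. -/
theorem rotation_coordinates (hn : X.numSquares = 7) (α : ℝ) :
    ∃ κ : ℝ, 0 < κ ∧ ∀ v : ℂ,
      (Complex.exp (Real.arctan α * Complex.I) * v / (√(X.numSquares : ℝ) : ℂ)).re =
        (v.re - α * v.im) / (7 * κ) ∧
      (Complex.exp (Real.arctan α * Complex.I) * v / (√(X.numSquares : ℝ) : ℂ)).im =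
        κ * (v.im + α / (1 + α ^ 2) * (v.re - α * v.im)) := by
  have hα : 0 < 1 + α ^ 2 := by positivity
  set s := √(1 + α ^ 2)
  have hs : s ^ 2 = 1 + α ^ 2 := Real.sq_sqrt hα.le
  have hs0 : 0 < s := Real.sqrt_pos.2 hα
  have h7 : (√7 : ℝ) ^ 2 = 7 := Real.sq_sqrt (by norm_num)
  have h70 : (0 : ℝ) < √7 := by positivity
  refine ⟨s / √7, by positivity, fun v => ?_⟩
  have he : Complex.exp (Real.arctan α * Complex.I) = ⟨1 / s, α / s⟩ := by
    rw [Complex.exp_mul_I, ← Complex.ofReal_cos, ← Complex.ofReal_sin, Real.cos_arctan,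
      Real.sin_arctan]
    apply Complex.ext <;> simp [s]
  rw [he, hn]
  simp only [Nat.cast_ofNat, Complex.div_ofReal_re, Complex.div_ofReal_im, Complex.mul_re,
    Complex.mul_im]
  constructor
  · rw [div_eq_div_iff h70.ne' (by positivity)]
    field_simp
    rw [h7]
  · field_simp
    rw [← hs]
    field_simp
    rw [hs]
    ring

/-- The maximum of `D / m²` as a maximum of real numbers. -/
theorem sup_eq (hX : X.InStratumTwo) (hn : X.numSquares = 7) (α : ℝ) (n : ℕ) :
    ((Finset.Icc 1 (CFrac.entry α (n + 1))).sup fun i : ℤ =>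
      ENNReal.ofReal (CFrac.D (n + 1) i α) /
        (((ModularGroup.S * CFrac.g (Function.update (CFrac.entry α) (n + 1) i) (n + 1) *
          ModularGroup.T ^ (-CFrac.entry α 0)) • X).multiplicity 1 0 : ENNReal) ^ 2) =
    (Finset.Icc 1 (CFrac.entry α (n + 1))).sup fun i : ℤ =>
      ENNReal.ofReal (D (n + 1) i α / (X.convMult α n i : ℝ) ^ 2) := by
  refine Finset.sup_congr rfl fun i hi => ?_
  rw [multiplicity_eq_convMult hX hn]
  have hm : (0 : ℝ) < X.convMult α n i := by
    rcases convMult_eq_one_or_two (X := X) (α := α) n i with h | h <;> rw [h] <;> norm_num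
  rw [ENNReal.ofReal_div_of_pos (by positivity), ENNReal.ofReal_pow hm.le, ENNReal.ofReal_natCast]

theorem lagrange_le (hn : X.numSquares = 7) (hα : Irrational α) {b b' : ℝ} (hb' : 1 < b')
    (hbb : b' < b) {N : ℕ}
    (h : ∀ n ≥ N, ∀ i, 1 ≤ i → i ≤ entry α (n + 1) →
      D (n + 1) i α / (X.convMult α n i : ℝ) ^ 2 ≤ b') :
    X.lagrange α ≤ 7 * ENNReal.ofReal b := by
  obtain ⟨κ, hκ, hrot⟩ := rotation_coordinates hn α
  obtain ⟨M, hM⟩ := exists_bound_of_convMult hα (α / (1 + α ^ 2)) κ hκ hb' hbb h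
  have hb : 0 < b := by linarith
  unfold lagrange lagrangeOfPeriods
  refine limsup_le_of_le (by isBoundedDefault) ?_
  rw [eventually_inf_principal, eventually_comap]
  filter_upwards [eventually_ge_atTop M] with r hr w hw
  rintro ⟨v, hv, rfl⟩
  obtain ⟨hre, him⟩ := hrot v
  dsimp only at hw ⊢
  rw [him] at hw
  rw [hre, him]
  have h1 := hM v hv (hw ▸ hr)
  have h2 : 1 / (7 * b) ≤ |(v.re - α * v.im) / (7 * κ)| *
      |κ * (v.im + α / (1 + α ^ 2) * (v.re - α * v.im))| := by
    rw [abs_div, abs_mul κ, abs_of_pos hκ, abs_of_pos (by positivity : 0 < 7 * κ)]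
    calc 1 / (7 * b) = (1 / b) / 7 := by field_simp
      _ ≤ (|v.re - α * v.im| * |v.im + α / (1 + α ^ 2) * (v.re - α * v.im)|) / 7 := by gcongr
      _ = _ := by field_simp
  calc _ ≤ (ENNReal.ofReal (1 / (7 * b)))⁻¹ := by gcongr
    _ = ENNReal.ofReal (7 * b) := by
      rw [← ENNReal.ofReal_inv_of_pos (by positivity), one_div, inv_inv]
    _ = 7 * ENNReal.ofReal b := by
      rw [ENNReal.ofReal_mul (by norm_num)]
      simp

theorem le_lagrange (hX : X.InStratumTwo) (hn : X.numSquares = 7) (hα : Irrational α) {b b' : ℝ}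
    (hb : 0 < b) (hbb : b < b')
    (h : ∀ N : ℕ, ∃ n ≥ N, ∃ i, 1 ≤ i ∧ i ≤ entry α (n + 1) ∧
      b' < D (n + 1) i α / (X.convMult α n i : ℝ) ^ 2) :
    7 * ENNReal.ofReal b ≤ X.lagrange α := by
  obtain ⟨κ, hκ, hrot⟩ := rotation_coordinates hn α
  have hM := exists_period_of_convMult hX hn hα (α / (1 + α ^ 2)) κ hκ hb hbb h
  unfold lagrange lagrangeOfPeriods
  refine le_limsup_of_frequently_le ?_ (by isBoundedDefault)
  rw [frequently_inf_principal, frequently_comap]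
  refine frequently_atTop.2 fun M => ?_
  obtain ⟨v, hv, h1, h2⟩ := hM M
  obtain ⟨hre, him⟩ := hrot v
  refine ⟨_, h1, _, congrArg abs him, ⟨v, hv, rfl⟩, ?_⟩
  rw [hre, him]
  have h3 : |(v.re - α * v.im) / (7 * κ)| *
      |κ * (v.im + α / (1 + α ^ 2) * (v.re - α * v.im))| ≤ 1 / (7 * b) := by
    rw [abs_div, abs_mul κ, abs_of_pos hκ, abs_of_pos (by positivity : 0 < 7 * κ)]
    calc _ = (|v.re - α * v.im| * |v.im + α / (1 + α ^ 2) * (v.re - α * v.im)|) / 7 := by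
          field_simp
      _ ≤ (1 / b) / 7 := by gcongr
      _ = 1 / (7 * b) := by field_simp
  calc 7 * ENNReal.ofReal b = ENNReal.ofReal (7 * b) := by
        rw [ENNReal.ofReal_mul (by norm_num)]
        simp
    _ = (ENNReal.ofReal (1 / (7 * b)))⁻¹ := by
      rw [← ENNReal.ofReal_inv_of_pos (by positivity), one_div, inv_inv]
    _ ≤ _ := by gcongr

/-- For the upper bound, `frequently_one_le` puts the limsup at 1 or more, which makes every bound
slightly above it eligible as b' > 1 in `lagrange_le`. The lower bound needs no such threshold. -/
theorem lagrange_eq (hX : X.InStratumTwo) (hn : X.numSquares = 7) (hα : Irrational α) :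
    X.lagrange α = 7 * limsup (fun n : ℕ => (Finset.Icc 1 (entry α (n + 1))).sup fun i : ℤ =>
      ENNReal.ofReal (D (n + 1) i α / (X.convMult α n i : ℝ) ^ 2)) atTop := by
  set r : ℕ → ENNReal := fun n => (Finset.Icc 1 (entry α (n + 1))).sup fun i : ℤ =>
      ENNReal.ofReal (D (n + 1) i α / (X.convMult α n i : ℝ) ^ 2) with hr
  apply le_antisymm
  · have h1 : 1 ≤ limsup r atTop := by
      refine le_limsup_of_frequently_le (frequently_atTop.2 fun N => ?_) (by isBoundedDefault)
      obtain ⟨n, hnN, i, hi1, hia, hD⟩ := frequently_one_le hX hn hα N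
      refine ⟨n, hnN, ?_⟩
      refine le_trans ?_ (Finset.le_sup (f := fun i : ℤ =>
        ENNReal.ofReal (D (n + 1) i α / (X.convMult α n i : ℝ) ^ 2)) (Finset.mem_Icc.2 ⟨hi1, hia⟩))
      rw [← ENNReal.ofReal_one]
      exact ENNReal.ofReal_le_ofReal hD
    rcases eq_or_ne (limsup r atTop) ⊤ with htop | htop
    · rw [htop, ENNReal.mul_top (by norm_num)]
      exact le_top
    set l := (limsup r atTop).toReal with hl
    have hlim : limsup r atTop = ENNReal.ofReal l := (ENNReal.ofReal_toReal htop).symm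
    have hl1 : 1 ≤ l := by
      rw [hlim, ENNReal.one_le_ofReal] at h1
      exact h1
    refine ENNReal.le_of_forall_pos_le_add fun ε hε _ => ?_
    have hε' : (0 : ℝ) < ε := hε
    -- Two distinct margins, ε/14 < ε/7, provide b' < b; the factor 7 turns the larger one into ε.
    have hlt : limsup r atTop < ENNReal.ofReal (l + ε / 14) := by
      rw [hlim]
      exact (ENNReal.ofReal_lt_ofReal_iff (by linarith)).2 (by linarith)
    obtain ⟨N, hN⟩ := eventually_atTop.1 (eventually_lt_of_limsup_lt hlt (by isBoundedDefault))
    refine (lagrange_le hn hα (b' := l + ε / 14) (b := l + ε / 7) (by linarith) (by linarith)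
      (N := N) fun n hnN i hi1 hia => ?_).trans ?_
    · have h2 := (Finset.le_sup (f := fun i : ℤ =>
        ENNReal.ofReal (D (n + 1) i α / (X.convMult α n i : ℝ) ^ 2))
          (Finset.mem_Icc.2 ⟨hi1, hia⟩)).trans (hN n hnN).le
      exact (ENNReal.ofReal_le_ofReal_iff (by linarith)).1 h2
    · rw [hlim, ENNReal.ofReal_add (by linarith) (by positivity), mul_add]
      gcongr
      rw [show (7 : ENNReal) = ENNReal.ofReal 7 by simp, ← ENNReal.ofReal_mul (by norm_num),
        mul_div_cancel₀ _ (by norm_num), ENNReal.ofReal_coe_nnreal]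
  · refine ENNReal.mul_le_of_forall_lt fun c hc b hb => ?_
    refine (mul_le_mul_left hc.le b).trans ?_
    obtain ⟨b', hbb', hb'⟩ := exists_between hb
    have hbt : b ≠ ⊤ := hb.ne_top
    have hbt' : b' ≠ ⊤ := hb'.ne_top
    rcases eq_or_ne b 0 with rfl | hb0
    · simp
    rw [← ENNReal.ofReal_toReal hbt]
    refine le_lagrange hX hn hα (b' := b'.toReal) (ENNReal.toReal_pos hb0 hbt)
      ((ENNReal.toReal_lt_toReal hbt hbt').2 hbb') fun N => ?_
    obtain ⟨n, hnN, hlt⟩ := frequently_atTop.1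
      (frequently_lt_of_lt_limsup (by isBoundedDefault) hb') N
    obtain ⟨i, hi, hlt'⟩ := Finset.lt_sup_iff.1 hlt
    rw [Finset.mem_Icc] at hi
    exact ⟨n, hnN, i, hi.1, hi.2, (ENNReal.lt_ofReal_iff_toReal_lt hbt').1 hlt'⟩

end Origami

theorem mainTheorem4 (X : Origami.{u}) (hX : X.IsOrbitB7) (α : ℝ) (hα : Irrational α) :
    (∀ A : Matrix.SpecialLinearGroup (Fin 2) ℤ,
      (A • X).multiplicity 1 0 = 1 ∨ (A • X).multiplicity 1 0 = 2) ∧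
    X.lagrange α =
      7 * limsup (fun n : ℕ =>
        (Finset.Icc 1 (CFrac.entry α n)).sup fun i : ℤ =>
          ENNReal.ofReal (CFrac.D n i α) /
            (((ModularGroup.S * CFrac.g (Function.update (CFrac.entry α) n i) n *
              ModularGroup.T ^ (-CFrac.entry α 0)) • X).multiplicity 1 0 : ENNReal) ^ 2)
        atTop := by
  obtain ⟨hn, hX2, -, -⟩ := hX
  refine ⟨Origami.multiplicity_smul_eq_one_or_two hX2 hn, ?_⟩
  rw [Origami.lagrange_eq hX2 hn hα]
  -- Shifting the index drops the term n = 0, where a_0 is not a partial quotient in the relevant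
  -- sense; the limsup does not see it.
  refine congrArg (7 * ·) (Eq.trans ?_ (limsup_nat_add _ 1))
  simp only [Origami.sup_eq hX2 hn]
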